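/- A Young function is a function $A:[0,\infty)\to[0,\infty]$ of the form $A(s)=\int_0^s a(r)\,dr$, where $a:[0,\infty)\to[0,\infty]$ is nondecreasing and left-continuous, $a(0)=0$, and $a$ is neither identically $0$ nor identically $\infty$ on $(0,\infty)$. Let $A^{-1}(r)=\inf\{s\ge 0: A(s)>r\}$ be its right-continuous inverse, and define its local upper Boyd index by $$I_A=\inf_{0<t<1}\frac{\log t}{\log h_A(t)},\qquad h_A(t)=\limsup_{s\to\infty}\frac{A^{-1}(st)}{A^{-1}(s)},$$ where the quotient is read as $\infty$ if $h_A(t)=1$. For an open set $\Omega\subset\mathbb{R}^n$, $L^A(\Omega)$ is the space of measurable $f:\Omega\to\mathbb{R}$ with $\int_\Omega A(|f|/\lambda)\,dx<\infty$ for some $\lambda>0$, with the Luxemburg norm $\|f\|_{L^A(\Omega)}=\inf\{\lambda>0:\int_\Omega A(|f|/\lambda)\,dx\le 1\}$, and $W^{m,A}(\Omega)$ is the space of those $u\in L^A(\Omega)$ whose weak derivatives $\nabla^\alpha u$ in $\Omega$ exist and belong to $L^A(\Omega)$ for all multi-indices $\alpha$ with $|\alpha|\le m$, with the norm $\|u\|_{W^{m,A}(\Omega)}=\sum_{|\alpha|\le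 m}\|\nabla^\alpha u\|_{L^A(\Omega)}$. **Theorem.** Let $1\le m<n$ be integers, and let $A$ be a Young function such that $\int_0^\delta\left(\frac{s}{A(s)}\right)^{\frac{m}{n-m}}ds<\infty$ for some $\delta>0$ and $I_A<\frac nm$. Put $A_{\frac nm}=A\circ H_{\frac nm}^{-1}$, where $$H_{\frac nm}(r)=\left(\int_0^r\left(\frac{t}{A(t)}\right)^{\frac{m}{n-m}}dt\right)^{\frac{n-m}{n}},\qquad r\ge 0,$$ and $H_{\frac nm}^{-1}(s)=\inf\{r\ge 0:H_{\frac nm}(r)\ge s\}$ is its generalized left-continuous inverse (with $\inf\emptyset=\infty$ and $A(\infty)=\infty$). Let $\Omega\subset\mathbb{R}^n$ be an open set for which the continuous embedding $W^{m,A}(\Omega)\hookrightarrow L^{A_{n/m}}(\Omega)$ holds, that is, $W^{m,A}(\Omega)\subset L^{A_{n/m}}(\Omega)$ and there is a constant $C$ with $\|u\|_{L^{A_{n/m}}(\Omega)}\le C\|u\|_{W^{m,A}(\Omega)}$ for all $u\in W^{m,A}(\Omega)$. Then $\Omega$ satisfies the measure density condition: there is a constant $c>0$ such that $|B(x,r)\cap\Omega|\ge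 c\,r^n$ for all $x\in\Omega$ and all $0<r\le 1$. -/

import Mathlib

open MeasureTheory Filter Set
open scoped ENNReal NNReal

noncomputable section

namespace OrliczSobolev

/-! ### Young functions -/

/-- `A : [0,∞) → [0,∞]` is a Young function: `A s = ∫_0^s a r dr` with `a : [0,∞) → [0,∞]`
nondecreasing and left-continuous, `a 0 = 0`, and `a` neither identically `0` nor identically `∞`
on `(0,∞)`. -/
def IsYoung (A : ℝ≥0 → ℝ≥0∞) : Prop :=
  ∃ a : ℝ≥0 → ℝ≥0∞, a 0 = 0 ∧ Monotone a ∧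
    (∀ s, ContinuousWithinAt a (Iic s) s) ∧
    (∃ r, 0 < r ∧ a r ≠ 0) ∧ (∃ r, 0 < r ∧ a r ≠ ∞) ∧
    ∀ s : ℝ≥0, A s = ∫⁻ r in Ioc (0 : ℝ) s, a r.toNNReal

/-- The right-continuous inverse `F⁻¹(r) = inf {s ≥ 0 : F s > r}` of a nondecreasing function. -/
def rightInv (F : ℝ≥0 → ℝ≥0∞) (r : ℝ≥0) : ℝ≥0∞ :=
  ⨅ (s : ℝ≥0) (_ : (r : ℝ≥0∞) < F s), (s : ℝ≥0∞)

/-- The left-continuous inverse `F⁻¹(r) = inf {s ≥ 0 : F s ≥ r}` of a nondecreasing function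
(with `inf ∅ = ∞`). -/
def leftInv (F : ℝ≥0 → ℝ≥0∞) (r : ℝ≥0) : ℝ≥0∞ :=
  ⨅ (s : ℝ≥0) (_ : (r : ℝ≥0∞) ≤ F s), (s : ℝ≥0∞)

/-- Extension of a Young function to `[0,∞]` by `A ∞ = ∞`. -/
def extendTop (A : ℝ≥0 → ℝ≥0∞) (s : ℝ≥0∞) : ℝ≥0∞ :=
  if s = ∞ then ∞ else A s.toNNReal

/-! ### The local upper Boyd index -/

/-- `h_A(t) = limsup_{s → ∞} A⁻¹(s t) / A⁻¹(s)`. -/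
def boydFun (A : ℝ≥0 → ℝ≥0∞) (t : ℝ≥0) : ℝ≥0∞ :=
  limsup (fun s : ℝ≥0 => rightInv A (s * t) / rightInv A s) atTop

/-- `I_A = inf_{0 < t < 1} log t / log h_A(t)`. For `0 < t < 1` one has `h_A(t) ≤ 1`, so the quotient
is written as `(-log t) / (-log h_A(t))` in `[0,∞]`; it is `∞` when `h_A(t) = 1`. -/
def upperBoydIndex (A : ℝ≥0 → ℝ≥0∞) : ℝ≥0∞ :=
  ⨅ (t : ℝ≥0) (_ : 0 < t ∧ t < 1),
    (-(ENNReal.log (t : ℝ≥0∞))).toENNReal / (-(ENNReal.log (boydFun A t))).toENNReal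

/-! ### The optimal target -/

/-- The integral `∫_0^r (t / A t)^{m/(n-m)} dt`. -/
def subcritIntegral (n m : ℕ) (A : ℝ≥0 → ℝ≥0∞) (r : ℝ≥0) : ℝ≥0∞ :=
  ∫⁻ t in Ioc (0 : ℝ) r, (ENNReal.ofReal t / A t.toNNReal) ^ ((m : ℝ) / ((n : ℝ) - m))

/-- `H_{n/m}(r) = (∫_0^r (t / A t)^{m/(n-m)} dt)^{(n-m)/n}`. -/
def cianchiH (n m : ℕ) (A : ℝ≥0 → ℝ≥0∞) (r : ℝ≥0) : ℝ≥0∞ :=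
  (subcritIntegral n m A r) ^ (((n : ℝ) - m) / n)

/-- `A_{n/m} = A ∘ H_{n/m}⁻¹`, with the left-continuous inverse of `H_{n/m}`. -/
def sobolevConj (n m : ℕ) (A : ℝ≥0 → ℝ≥0∞) (s : ℝ≥0) : ℝ≥0∞ :=
  extendTop A (leftInv (cianchiH n m A) s)

/-! ### Orlicz spaces -/

/-- The modular `∫_Ω A(|f| / lam) dx`. -/
def modular {n : ℕ} (A : ℝ≥0 → ℝ≥0∞) (Ω : Set (EuclideanSpace ℝ (Fin n)))
    (f : EuclideanSpace ℝ (Fin n) → ℝ) (lam : ℝ≥0) : ℝ≥0∞ :=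
  ∫⁻ x in Ω, A (‖f x‖₊ / lam)

/-- `f ∈ L^A(Ω)`. -/
def MemOrlicz {n : ℕ} (A : ℝ≥0 → ℝ≥0∞) (Ω : Set (EuclideanSpace ℝ (Fin n)))
    (f : EuclideanSpace ℝ (Fin n) → ℝ) : Prop :=
  AEMeasurable f (volume.restrict Ω) ∧ ∃ lam : ℝ≥0, 0 < lam ∧ modular A Ω f lam < ∞

/-- The Luxemburg norm of `f` in `L^A(Ω)`. -/
def luxNorm {n : ℕ} (A : ℝ≥0 → ℝ≥0∞) (Ω : Set (EuclideanSpace ℝ (Fin n)))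
    (f : EuclideanSpace ℝ (Fin n) → ℝ) : ℝ≥0∞ :=
  ⨅ (lam : ℝ≥0) (_ : 0 < lam ∧ modular A Ω f lam ≤ 1), (lam : ℝ≥0∞)

/-! ### Weak derivatives and Orlicz-Sobolev spaces -/

/-- The classical partial derivative `∂_i φ`. -/
def partialDeriv {n : ℕ} (i : Fin n) (φ : EuclideanSpace ℝ (Fin n) → ℝ) :
    EuclideanSpace ℝ (Fin n) → ℝ :=
  fun x => fderiv ℝ φ x (EuclideanSpace.single i 1)

/-- The classical derivative `∂_1^{α_1} ⋯ ∂_n^{α_n} φ` of multi-index order `α`. -/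
def multiDeriv {n : ℕ} (α : Fin n → ℕ) (φ : EuclideanSpace ℝ (Fin n) → ℝ) :
    EuclideanSpace ℝ (Fin n) → ℝ :=
  (List.finRange n).foldr (fun i g => (partialDeriv i)^[α i] g) φ

/-- `v` is a weak derivative of `u` of multi-index order `α` in `Ω`. -/
def IsWeakDeriv {n : ℕ} (Ω : Set (EuclideanSpace ℝ (Fin n))) (α : Fin n → ℕ)
    (u v : EuclideanSpace ℝ (Fin n) → ℝ) : Prop :=
  LocallyIntegrableOn u Ω ∧ LocallyIntegrableOn v Ω ∧
    ∀ φ : EuclideanSpace ℝ (Fin n) → ℝ, ContDiff ℝ ((⊤ : ℕ∞) : WithTop ℕ∞) φ → HasCompactSupport φ → tsupport φ ⊆ Ω →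
      ∫ x in Ω, u x * multiDeriv α φ x = (-1) ^ (∑ i, α i) * ∫ x in Ω, v x * φ x

open Classical in
/-- The weak derivative `∇^α u` in `Ω` (a representative; it is unique up to null sets in an open
set `Ω`), and `0` if there is none. -/
def weakDeriv {n : ℕ} (Ω : Set (EuclideanSpace ℝ (Fin n))) (α : Fin n → ℕ)
    (u : EuclideanSpace ℝ (Fin n) → ℝ) : EuclideanSpace ℝ (Fin n) → ℝ :=
  if h : ∃ v, IsWeakDeriv Ω α u v then h.choose else 0

/-- The multi-indices `α` with `|α| = α_1 + ⋯ + α_n ≤ m`. -/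
def multiIndices (n m : ℕ) : Finset (Fin n → ℕ) :=
  (Finset.Iic (fun _ : Fin n => m)).filter (fun α => ∑ i, α i ≤ m)

theorem mem_multiIndices {n m : ℕ} {α : Fin n → ℕ} :
    α ∈ multiIndices n m ↔ ∑ i, α i ≤ m := by
  refine ⟨fun h => (Finset.mem_filter.1 h).2, fun h => Finset.mem_filter.2 ⟨?_, h⟩⟩
  exact Finset.mem_Iic.2 fun i =>
    (Finset.single_le_sum (fun j _ => Nat.zero_le (α j)) (Finset.mem_univ i)).trans h

/-- `u ∈ W^{m,A}(Ω)`. -/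
def MemSobolev {n : ℕ} (m : ℕ) (A : ℝ≥0 → ℝ≥0∞) (Ω : Set (EuclideanSpace ℝ (Fin n)))
    (u : EuclideanSpace ℝ (Fin n) → ℝ) : Prop :=
  MemOrlicz A Ω u ∧ ∀ α : Fin n → ℕ, ∑ i, α i ≤ m →
    (∃ v, IsWeakDeriv Ω α u v) ∧ MemOrlicz A Ω (weakDeriv Ω α u)

/-- `‖u‖_{W^{m,A}(Ω)} = ∑_{|α| ≤ m} ‖∇^α u‖_{L^A(Ω)}`. -/
def sobolevNorm {n : ℕ} (m : ℕ) (A : ℝ≥0 → ℝ≥0∞) (Ω : Set (EuclideanSpace ℝ (Fin n)))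
    (u : EuclideanSpace ℝ (Fin n) → ℝ) : ℝ≥0∞ :=
  ∑ α ∈ multiIndices n m, luxNorm A Ω (weakDeriv Ω α u)

/-- The continuous embedding `W^{m,A}(Ω) ↪ L^B(Ω)`. -/
def ContinuousEmbedding {n : ℕ} (m : ℕ) (A B : ℝ≥0 → ℝ≥0∞)
    (Ω : Set (EuclideanSpace ℝ (Fin n))) : Prop :=
  ∃ C : ℝ≥0, ∀ u, MemSobolev m A Ω u →
    MemOrlicz B Ω u ∧ luxNorm B Ω u ≤ C * sobolevNorm m A Ω u

/-! ### The measure density condition -/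

/-- There is `c > 0` with `|B(x,r) ∩ Ω| ≥ c r^n` for all `x ∈ Ω` and `0 < r ≤ 1`. -/
def MeasureDensity {n : ℕ} (Ω : Set (EuclideanSpace ℝ (Fin n))) : Prop :=
  ∃ c : ℝ, 0 < c ∧ ∀ x ∈ Ω, ∀ r : ℝ, 0 < r → r ≤ 1 →
    ENNReal.ofReal (c * r ^ n) ≤ volume (Metric.ball x r ∩ Ω)

end OrliczSobolev

end

/-!
The embedding is tested on cutoff functions between concentric cubes. Fix `x ∈ Ω` and write `V r`
for the measure of the part of `Ω` in the cube of centre `x` and half side `r`. Let `r < R ≤ 1` with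
`V r ≥ V R / 2`, and let `u` be a smooth function equal to `1` on the smaller cube and supported in
the larger one, with `|∇^α u| ≤ C (R - r) ^ (-|α|)` (`exists_cutoff`). Its classical derivatives,
taken in reverse order, are weak derivatives, and weak derivatives in an open set are unique almost
everywhere (`weakDeriv_ae_eq`), so that

* `‖u‖_{W^{m,A}} ≤ C (R - r) ^ (-m) / A⁻¹ (1 / V R)` (`exists_testFunction`);
* `‖u‖_{L^{A_{n/m}}} ≥ 1 / H (2 A⁻¹ s)` with `s = 2 / V R`, because the inverse of `A_{n/m}` is
  `H ∘ A⁻¹` (`le_luxNorm_sobolevConj`).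

The index condition `I_A < n / m` says that `A⁻¹ (s t) ≤ q A⁻¹ s` for large `s`, with some `t < 1` and
`q < t ^ (m / n)`. Splitting the integral in `H` at the points `2 A⁻¹ (s t ^ k)` gives a geometric
series, whence `H (2 A⁻¹ s) ≤ K A⁻¹ s * s ^ (-m / n)` for large `s` (`exists_cianchiH_le`). The
embedding then yields `(R - r) ^ m ≤ C s ^ (-m / n)`, that is, `R - r ≤ C (V R) ^ (1 / n)` as long as
`V R` is small (`exists_gap_le`).

Passing repeatedly to a radius at which `V` has dropped to half, the gaps between successive radii
are bounded by a geometric series, and the radii tend to `0` since `x` is interior to `Ω`. Hence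
`R ≤ C (V R) ^ (1 / n)` (`le_mul_rpow_of_gap`). When `V R` is not small there is nothing to prove,
and passing from cubes to balls costs a factor depending on `n` only.

Of the Young function only this is used: `A` is nondecreasing, finite and nonzero somewhere, and
`A (c s) ≤ c A s` for `c ≤ 1`. In particular `A` is not assumed finite, and its inverse is never
evaluated exactly: a factor `2` in the argument makes up for it.
-/

namespace OrliczSobolev

open scoped ContDiff

/-! ### Iterated directional derivatives and weak derivatives of smooth functions -/

/-- The iterated partial derivative `∂_{l_1} (∂_{l_2} (⋯ f))` along a list `l` of directions. -/
noncomputable def listDeriv {n : ℕ} (l : List (Fin n)) (f : EuclideanSpace ℝ (Fin n) → ℝ) :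
    EuclideanSpace ℝ (Fin n) → ℝ :=
  l.foldr partialDeriv f

section ListDeriv

variable {n : ℕ} {f g φ : EuclideanSpace ℝ (Fin n) → ℝ}

theorem contDiff_partialDeriv (i : Fin n) (hf : ContDiff ℝ ∞ f) :
    ContDiff ℝ ∞ (partialDeriv i f) :=
  (hf.fderiv_right (m := ∞) (by simp)).clm_apply contDiff_const

theorem contDiff_listDeriv (l : List (Fin n)) (hf : ContDiff ℝ ∞ f) :
    ContDiff ℝ ∞ (listDeriv l f) := by
  induction l with
  | nil => exact hf
  | cons i l ih => exact contDiff_partialDeriv i ih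

theorem tsupport_listDeriv_subset (l : List (Fin n)) :
    tsupport (listDeriv l f) ⊆ tsupport f := by
  induction l with
  | nil => exact subset_rfl
  | cons i l ih => exact (tsupport_fderiv_apply_subset ℝ _).trans ih

theorem hasCompactSupport_listDeriv (l : List (Fin n)) (hf : HasCompactSupport f) :
    HasCompactSupport (listDeriv l f) :=
  hf.of_isClosed_subset (isClosed_tsupport _) (tsupport_listDeriv_subset l)

theorem norm_iteratedFDeriv_partialDeriv_le (i : Fin n) (hf : ContDiff ℝ ∞ f) (k : ℕ)
    (x : EuclideanSpace ℝ (Fin n)) :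
    ‖iteratedFDeriv ℝ k (partialDeriv i f) x‖ ≤ ‖iteratedFDeriv ℝ (k + 1) f x‖ := by
  have h := (ContinuousLinearMap.apply ℝ ℝ (EuclideanSpace.single i (1 : ℝ))).norm_iteratedFDeriv_comp_left
    (f := fderiv ℝ f) (x := x) (N := ∞) (n := k)
    (hf.fderiv_right (m := ∞) (by simp)).contDiffAt (by exact_mod_cast le_top)
  rw [norm_iteratedFDeriv_fderiv] at h
  refine h.trans (mul_le_of_le_one_left (norm_nonneg _) ?_)
  refine ContinuousLinearMap.opNorm_le_bound _ zero_le_one fun L => ?_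
  simpa using L.le_opNorm (EuclideanSpace.single i (1 : ℝ))

theorem norm_iteratedFDeriv_listDeriv_le (l : List (Fin n)) (hf : ContDiff ℝ ∞ f) (k : ℕ)
    (x : EuclideanSpace ℝ (Fin n)) :
    ‖iteratedFDeriv ℝ k (listDeriv l f) x‖ ≤ ‖iteratedFDeriv ℝ (k + l.length) f x‖ := by
  induction l generalizing k with
  | nil => exact le_rfl
  | cons i l ih =>
    refine (norm_iteratedFDeriv_partialDeriv_le i (contDiff_listDeriv l hf) k x).trans ?_
    refine (ih (k + 1)).trans_eq ?_
    rw [List.length_cons, add_assoc, add_comm 1]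

theorem abs_listDeriv_le (l : List (Fin n)) (hf : ContDiff ℝ ∞ f)
    (x : EuclideanSpace ℝ (Fin n)) :
    |listDeriv l f x| ≤ ‖iteratedFDeriv ℝ l.length f x‖ := by
  have h := norm_iteratedFDeriv_listDeriv_le l hf 0 x
  rwa [zero_add, norm_iteratedFDeriv_zero, Real.norm_eq_abs] at h

theorem integral_mul_partialDeriv (i : Fin n) (hf : ContDiff ℝ ∞ f) (hφ : ContDiff ℝ ∞ φ)
    (hc : HasCompactSupport φ) :
    ∫ x, f x * partialDeriv i φ x = -∫ x, partialDeriv i f x * φ x := by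
  have hc' : HasCompactSupport (partialDeriv i φ) := hasCompactSupport_listDeriv [i] hc
  refine integral_mul_fderiv_eq_neg_fderiv_mul_of_integrable ?_ ?_ ?_
    (fun x _ => hf.differentiable (by simp) x) (fun x _ => hφ.differentiable (by simp) x)
  · exact ((contDiff_partialDeriv i hf).continuous.mul hφ.continuous).integrable_of_hasCompactSupport
      hc.mul_left
  · exact (hf.continuous.mul (contDiff_partialDeriv i hφ).continuous).integrable_of_hasCompactSupport
      hc'.mul_left
  · exact (hf.continuous.mul hφ.continuous).integrable_of_hasCompactSupport hc.mul_left

/-- Integration by parts moves the derivatives one at a time, so they reach `f` in the reverse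
order. -/
theorem integral_mul_listDeriv (l : List (Fin n)) (hf : ContDiff ℝ ∞ f) (hφ : ContDiff ℝ ∞ φ)
    (hc : HasCompactSupport φ) :
    ∫ x, f x * listDeriv l φ x = (-1) ^ l.length * ∫ x, listDeriv l.reverse f x * φ x := by
  induction l generalizing f with
  | nil => simp [listDeriv]
  | cons i l ih =>
    have h := integral_mul_partialDeriv i hf (contDiff_listDeriv l hφ)
      (hasCompactSupport_listDeriv l hc)
    have h2 : listDeriv (i :: l).reverse f = listDeriv l.reverse (partialDeriv i f) := by
      simp [listDeriv]
    rw [h2, List.length_cons, pow_succ, mul_neg_one, neg_mul, ← ih (contDiff_partialDeriv i hf)]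
    exact h

/-- The list of directions in which a multi-index `α` differentiates: `i` occurs `α i` times. -/
def indexList (α : Fin n → ℕ) : List (Fin n) :=
  (List.finRange n).flatMap fun i => List.replicate (α i) i

theorem length_indexList (α : Fin n → ℕ) : (indexList α).length = ∑ i, α i := by
  simp [indexList, List.length_flatMap, Fin.sum_univ_def]

theorem multiDeriv_eq_listDeriv (α : Fin n → ℕ) (f : EuclideanSpace ℝ (Fin n) → ℝ) :
    multiDeriv α f = listDeriv (indexList α) f := by
  have key : ∀ L : List (Fin n),
      L.foldr (fun i g => (partialDeriv i)^[α i] g) f =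
        listDeriv (L.flatMap fun i => List.replicate (α i) i) f := by
    intro L
    induction L with
    | nil => rfl
    | cons i L ih =>
      rw [List.foldr_cons, ih, List.flatMap_cons]
      simp only [listDeriv, List.foldr_append]
      generalize List.foldr partialDeriv f _ = h
      induction α i with
      | zero => rfl
      | succ k ihk => rw [Function.iterate_succ_apply', ihk, List.replicate_succ, List.foldr_cons]
  exact key _

theorem isWeakDeriv_listDeriv (Ω : Set (EuclideanSpace ℝ (Fin n))) (α : Fin n → ℕ)
    (hf : ContDiff ℝ ∞ f) :
    IsWeakDeriv Ω α f (listDeriv (indexList α).reverse f) := by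
  refine ⟨hf.continuous.locallyIntegrable.locallyIntegrableOn Ω,
    (contDiff_listDeriv _ hf).continuous.locallyIntegrable.locallyIntegrableOn Ω, ?_⟩
  intro φ hφ hc hsub
  have hout : ∀ x, x ∉ Ω → x ∉ tsupport φ := fun x hx h => hx (hsub h)
  rw [setIntegral_eq_integral_of_forall_compl_eq_zero,
    setIntegral_eq_integral_of_forall_compl_eq_zero, multiDeriv_eq_listDeriv,
    integral_mul_listDeriv _ hf hφ hc, length_indexList]
  · intro x hx
    rw [image_eq_zero_of_notMem_tsupport (hout x hx), mul_zero]
  · intro x hx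
    rw [multiDeriv_eq_listDeriv, image_eq_zero_of_notMem_tsupport
      (fun h => hout x hx (tsupport_listDeriv_subset _ h)), mul_zero]

theorem IsWeakDeriv.ae_eq {Ω : Set (EuclideanSpace ℝ (Fin n))} (hΩ : IsOpen Ω) {α : Fin n → ℕ}
    {v w : EuclideanSpace ℝ (Fin n) → ℝ} (hv : IsWeakDeriv Ω α f v) (hw : IsWeakDeriv Ω α f w) :
    v =ᵐ[volume.restrict Ω] w := by
  have key : ∀ᵐ x ∂(volume : Measure (EuclideanSpace ℝ (Fin n))), x ∈ Ω → (v - w) x = 0 := by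
    refine hΩ.ae_eq_zero_of_integral_contDiff_smul_eq_zero (hv.2.1.sub hw.2.1) ?_
    intro φ hφ hc hsub
    have hout : ∀ x, x ∉ Ω → φ x = 0 := fun x hx =>
      image_eq_zero_of_notMem_tsupport fun h => hx (hsub h)
    have hint : ∀ z : EuclideanSpace ℝ (Fin n) → ℝ, LocallyIntegrableOn z Ω →
        Integrable (fun x => z x * φ x) (volume.restrict Ω) := by
      intro z hz
      have h1 : IntegrableOn (fun x => φ x • z x) (tsupport φ) :=
        (hz.integrableOn_compact_subset hsub hc).continuousOn_smul hφ.continuous.continuousOn hc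
      have h2 : Integrable (fun x => φ x • z x) :=
        (integrableOn_iff_integrable_of_support_subset
          ((Function.support_smul_subset_left φ z).trans (subset_tsupport φ))).1 h1
      refine (h2.congr (ae_of_all _ fun x => ?_)).integrableOn
      simp [mul_comm]
    have h1 := hv.2.2 φ hφ hc hsub
    rw [hw.2.2 φ hφ hc hsub] at h1
    have h2 := mul_left_cancel₀ (pow_ne_zero _ (by norm_num)) h1
    rw [← setIntegral_eq_integral_of_forall_compl_eq_zero (s := Ω)]
    · have : ∀ x, φ x • (v - w) x = v x * φ x - w x * φ x := fun x => by
        simp only [smul_eq_mul, Pi.sub_apply]; ring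
      simp_rw [this]
      rw [integral_sub (hint v hv.2.1) (hint w hw.2.1), ← h2, sub_self]
    · intro x hx
      rw [hout x hx, zero_smul]
  filter_upwards [(ae_restrict_iff' hΩ.measurableSet).2 key] with x hx
  exact sub_eq_zero.1 hx

theorem weakDeriv_ae_eq {Ω : Set (EuclideanSpace ℝ (Fin n))} (hΩ : IsOpen Ω) (α : Fin n → ℕ)
    (hf : ContDiff ℝ ∞ f) :
    weakDeriv Ω α f =ᵐ[volume.restrict Ω] listDeriv (indexList α).reverse f := by
  have h : ∃ v, IsWeakDeriv Ω α f v := ⟨_, isWeakDeriv_listDeriv Ω α hf⟩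
  rw [weakDeriv, dif_pos h]
  exact h.choose_spec.ae_eq hΩ (isWeakDeriv_listDeriv Ω α hf)

end ListDeriv

/-! ### Cutoff functions between concentric cubes -/

theorem exists_norm_iteratedFDeriv_smoothTransition_le (k : ℕ) :
    ∃ M : ℝ, ∀ x, ‖iteratedFDeriv ℝ k Real.smoothTransition x‖ ≤ M := by
  have hcd : ContDiff ℝ ∞ Real.smoothTransition := Real.smoothTransition.contDiff
  obtain ⟨M, hM⟩ := isCompact_Icc.exists_bound_of_continuousOn (s := Icc (0 : ℝ) 1)
    (hcd.continuous_iteratedFDeriv (m := k) (by exact_mod_cast le_top)).continuousOn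
  have hconst : ∀ c x : ℝ, |c| ≤ 1 → ‖iteratedFDeriv ℝ k (fun _ : ℝ => c) x‖ ≤ 1 := by
    intro c x hc
    rcases Nat.eq_zero_or_pos k with rfl | hk
    · simpa using hc
    · rw [iteratedFDeriv_const_of_ne hk.ne']; simp
  refine ⟨max M 1, fun x => ?_⟩
  rcases lt_or_ge x 0 with hx | hx
  · have h : Real.smoothTransition =ᶠ[nhds x] fun _ => 0 := by
      filter_upwards [gt_mem_nhds hx] with y hy
      exact Real.smoothTransition.zero_of_nonpos (le_of_lt hy)
    rw [(h.iteratedFDeriv ℝ k).eq_of_nhds]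
    exact (hconst 0 x (by simp)).trans (le_max_right _ _)
  rcases lt_or_ge 1 x with hx1 | hx1
  · have h : Real.smoothTransition =ᶠ[nhds x] fun _ => 1 := by
      filter_upwards [lt_mem_nhds hx1] with y hy
      exact Real.smoothTransition.one_of_one_le (le_of_lt hy)
    rw [(h.iteratedFDeriv ℝ k).eq_of_nhds]
    exact (hconst 1 x (by simp)).trans (le_max_right _ _)
  · exact (hM x ⟨hx, hx1⟩).trans (le_max_left _ _)

/-- `f` is smooth and its derivatives of order `k` are bounded by `a k * τ ^ k`: the derivative
bounds of a profile at length scale `τ⁻¹`. -/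
def ScaleBound {E : Type*} [NormedAddCommGroup E] [NormedSpace ℝ E] (a : ℕ → ℝ) (τ : ℝ)
    (f : E → ℝ) : Prop :=
  ContDiff ℝ ∞ f ∧ ∀ k x, ‖iteratedFDeriv ℝ k f x‖ ≤ a k * τ ^ k

section ScaleBound

variable {E : Type*} [NormedAddCommGroup E] [NormedSpace ℝ E]

theorem ScaleBound.mul {a b : ℕ → ℝ} {τ : ℝ} {f g : E → ℝ} (hf : ScaleBound a τ f)
    (hg : ScaleBound b τ g) :
    ScaleBound (fun k => ∑ i ∈ Finset.range (k + 1), (k.choose i : ℝ) * a i * b (k - i)) τ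
      (fun x => f x * g x) := by
  refine ⟨hf.1.mul hg.1, fun k x => ?_⟩
  refine (norm_iteratedFDeriv_mul_le hf.1 hg.1 x (n := k) (by exact_mod_cast le_top)).trans ?_
  rw [Finset.sum_mul]
  refine Finset.sum_le_sum fun i hi => ?_
  have hik : i + (k - i) = k := by have := Finset.mem_range.1 hi; omega
  calc (k.choose i : ℝ) * ‖iteratedFDeriv ℝ i f x‖ * ‖iteratedFDeriv ℝ (k - i) g x‖
      ≤ (k.choose i : ℝ) * (a i * τ ^ i) * (b (k - i) * τ ^ (k - i)) := by
        have h0 : 0 ≤ a i * τ ^ i := (norm_nonneg _).trans (hf.2 i x)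
        gcongr
        · exact hf.2 i x
        · exact hg.2 _ x
    _ = (k.choose i : ℝ) * a i * b (k - i) * τ ^ (i + (k - i)) := by rw [pow_add]; ring
    _ = _ := by rw [hik]

/-- The bound on a finite product of functions with common derivative bounds depends on the
number of factors only. -/
theorem exists_scaleBound_prod {ι : Type*} (a : ℕ → ℝ) (s : Finset ι) :
    ∃ b : ℕ → ℝ, ∀ (τ : ℝ) (f : ι → E → ℝ), 0 ≤ τ → (∀ i, ScaleBound a τ (f i)) →
      ScaleBound b τ (fun x => ∏ i ∈ s, f i x) := by
  classical
  induction s using Finset.induction_on with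
  | empty =>
    refine ⟨fun _ => 1, fun τ f hτ _ => ⟨by simpa using contDiff_const, fun k x => ?_⟩⟩
    simp only [Finset.prod_empty]
    rcases Nat.eq_zero_or_pos k with rfl | hk
    · simp
    · rw [iteratedFDeriv_const_of_ne hk.ne']
      simpa using pow_nonneg hτ k
  | insert i s hi ih =>
    obtain ⟨b, hb⟩ := ih
    refine ⟨fun k => ∑ j ∈ Finset.range (k + 1), (k.choose j : ℝ) * a j * b (k - j),
      fun τ f hτ hf => ?_⟩
    simp only [Finset.prod_insert hi]
    exact (hf i).mul (hb τ f hτ hf)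

theorem exists_scaleBound_smoothTransition :
    ∃ a : ℕ → ℝ, ∀ (τ c : ℝ) (L : E →L[ℝ] ℝ), ‖L‖ ≤ τ →
      ScaleBound a τ (fun x => Real.smoothTransition (L x + c)) := by
  choose M hM using exists_norm_iteratedFDeriv_smoothTransition_le
  refine ⟨M, fun τ c L hL => ?_⟩
  have hS : ContDiff ℝ ∞ Real.smoothTransition := Real.smoothTransition.contDiff
  have hSc : ContDiff ℝ ∞ (fun t : ℝ => Real.smoothTransition (t + c)) :=
    hS.comp (contDiff_id.add contDiff_const)
  refine ⟨hSc.comp L.contDiff, fun k x => ?_⟩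
  have h := L.iteratedFDeriv_comp_right hSc x (i := k) (by exact_mod_cast le_top)
  change ‖iteratedFDeriv ℝ k ((fun t : ℝ => Real.smoothTransition (t + c)) ∘ L) x‖ ≤ _
  rw [h]
  refine (ContinuousMultilinearMap.norm_compContinuousLinearMap_le _ _).trans ?_
  rw [iteratedFDeriv_comp_add_right, Finset.prod_const, Finset.card_univ, Fintype.card_fin]
  have h0 : 0 ≤ M k := (norm_nonneg _).trans (hM k 0)
  gcongr
  exact hM k _

end ScaleBound

/-- The open cube with centre `x` and half side length `r`. -/
def cube {n : ℕ} (x : EuclideanSpace ℝ (Fin n)) (r : ℝ) : Set (EuclideanSpace ℝ (Fin n)) :=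
  {y | ∀ i, |y i - x i| < r}

theorem isOpen_cube {n : ℕ} (x : EuclideanSpace ℝ (Fin n)) (r : ℝ) : IsOpen (cube x r) := by
  simp only [cube, ofPred_forall]
  exact isOpen_iInter_of_finite fun i => isOpen_lt (by fun_prop) continuous_const

/-- Smooth cutoff functions between the cubes of half side `r` and `r + ρ`, with derivatives of
order `k` bounded by `C k * ρ ^ (-k)`, where `C` depends neither on the centre nor on `r` and `ρ`.
-/
theorem exists_cutoff (n : ℕ) :
    ∃ C : ℕ → ℝ, ∀ (x : EuclideanSpace ℝ (Fin n)) (r ρ : ℝ), 0 < ρ →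
      ∃ u : EuclideanSpace ℝ (Fin n) → ℝ, ScaleBound C ρ⁻¹ u ∧ (∀ y ∈ cube x r, u y = 1) ∧
        ∀ R, r + ρ < R → tsupport u ⊆ cube x R := by
  obtain ⟨a, ha⟩ := exists_scaleBound_smoothTransition (E := EuclideanSpace ℝ (Fin n))
  obtain ⟨C, hC⟩ := exists_scaleBound_prod (E := EuclideanSpace ℝ (Fin n)) _
    (Finset.univ : Finset (Fin n))
  refine ⟨C, fun x r ρ hρ => ?_⟩
  set P : Fin n → EuclideanSpace ℝ (Fin n) →L[ℝ] ℝ := fun i => EuclideanSpace.proj i with hP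
  have hPn : ∀ i, ‖P i‖ ≤ 1 := fun i => by
    refine ContinuousLinearMap.opNorm_le_bound _ zero_le_one fun y => ?_
    simpa [hP] using PiLp.norm_apply_le y i
  have hτ : 0 ≤ ρ⁻¹ := (inv_pos.2 hρ).le
  have hf : ∀ i, ScaleBound _ ρ⁻¹ (fun y => Real.smoothTransition ((ρ⁻¹ • P i) y +
      (r + ρ - x i) * ρ⁻¹) * Real.smoothTransition ((-ρ⁻¹ • P i) y + (r + ρ + x i) * ρ⁻¹)) :=
    fun i => (ha ρ⁻¹ _ _ (by
      rw [norm_smul, Real.norm_of_nonneg hτ]; exact mul_le_of_le_one_right hτ (hPn i))).mul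
      (ha ρ⁻¹ _ _ (by
      rw [norm_smul, norm_neg, Real.norm_of_nonneg hτ]; exact mul_le_of_le_one_right hτ (hPn i)))
  have e1 : ∀ i (y : EuclideanSpace ℝ (Fin n)), (ρ⁻¹ • P i) y + (r + ρ - x i) * ρ⁻¹ =
      (r + ρ + (y i - x i)) / ρ := fun i y => by
    simp [hP]; ring
  have e2 : ∀ i (y : EuclideanSpace ℝ (Fin n)), (-ρ⁻¹ • P i) y + (r + ρ + x i) * ρ⁻¹ =
      (r + ρ - (y i - x i)) / ρ := fun i y => by
    simp [hP]; ring
  simp only [e1, e2] at hf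
  refine ⟨_, hC ρ⁻¹ _ hτ hf, fun y hy => ?_, fun R hR => ?_⟩
  · refine Finset.prod_eq_one fun i _ => ?_
    have h := abs_lt.1 (hy i)
    rw [Real.smoothTransition.one_of_one_le ((one_le_div hρ).2 (by linarith)),
      Real.smoothTransition.one_of_one_le ((one_le_div hρ).2 (by linarith)), one_mul]
  · have hcl : IsClosed {y : EuclideanSpace ℝ (Fin n) | ∀ i, |y i - x i| ≤ r + ρ} := by
      simp only [ofPred_forall]
      exact isClosed_iInter fun i => isClosed_le (by fun_prop) continuous_const
    refine (closure_minimal (fun y hy => ?_) hcl).trans fun y hy i => (hy i).trans_lt hR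
    intro i
    by_contra hi
    refine hy (Finset.prod_eq_zero (Finset.mem_univ i) ?_)
    rcases lt_abs.1 (not_le.1 hi) with h | h
    · rw [Real.smoothTransition.zero_of_nonpos (x := (r + ρ - (y i - x i)) / ρ), mul_zero]
      exact div_nonpos_of_nonpos_of_nonneg (by linarith) hρ.le
    · rw [Real.smoothTransition.zero_of_nonpos (x := (r + ρ + (y i - x i)) / ρ), zero_mul]
      exact div_nonpos_of_nonpos_of_nonneg (by linarith) hρ.le

end OrliczSobolev

namespace OrliczSobolev

/-! ### Young functions and their inverses -/

section Young

variable {A : ℝ≥0 → ℝ≥0∞}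

theorem IsYoung.monotone (hA : IsYoung A) : Monotone A := by
  obtain ⟨a, -, -, -, -, -, h⟩ := hA
  intro s t hst
  rw [h, h]
  exact lintegral_mono_set (Ioc_subset_Ioc_right (by exact_mod_cast hst))

theorem IsYoung.map_zero (hA : IsYoung A) : A 0 = 0 := by
  obtain ⟨a, -, -, -, -, -, h⟩ := hA
  simp [h]

/-- The convexity of a Young function, in the only form in which it is used. -/
theorem IsYoung.map_mul_le (hA : IsYoung A) {c : ℝ≥0} (hc : c ≤ 1) (s : ℝ≥0) :
    A (c * s) ≤ c * A s := by
  obtain ⟨a, -, hmono, -, -, -, h⟩ := hA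
  obtain ⟨d, hd⟩ := exists_add_of_le hc
  have hcs : c * s ≤ s := mul_le_of_le_one_left' hc
  -- On `(0, c s]` the density is at most `a (c s)`, and on `(c s, s]` it is at least `a (c s)`.
  have h1 : A (c * s) ≤ c * s * a (c * s) := by
    rw [h]
    calc ∫⁻ r in Ioc (0 : ℝ) (c * s : ℝ≥0), a r.toNNReal
        ≤ ∫⁻ _ in Ioc (0 : ℝ) (c * s : ℝ≥0), a (c * s) :=
          setLIntegral_mono' measurableSet_Ioc fun r hr => hmono (Real.toNNReal_le_iff_le_coe.2 hr.2)
      _ = c * s * a (c * s) := by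
          rw [setLIntegral_const, Real.volume_Ioc, sub_zero, ENNReal.ofReal_coe_nnreal, mul_comm,
            ENNReal.coe_mul]
  have h2 : A (c * s) + d * s * a (c * s) ≤ A s := by
    rw [h s, ← Ioc_union_Ioc_eq_Ioc (b := ((c * s : ℝ≥0) : ℝ)) (by positivity)
      (by exact_mod_cast hcs), lintegral_union measurableSet_Ioc (Ioc_disjoint_Ioc_of_le le_rfl), ← h]
    gcongr
    calc (d : ℝ≥0∞) * s * a (c * s) = ∫⁻ _ in Ioc ((c * s : ℝ≥0) : ℝ) s, a (c * s) := by
          have e : (s : ℝ) - (c * s : ℝ≥0) = (d * s : ℝ≥0) := by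
            have hd' : (1 : ℝ) = c + d := by exact_mod_cast hd
            push_cast; linear_combination (s : ℝ) * hd'
          rw [setLIntegral_const, Real.volume_Ioc, e, ENNReal.ofReal_coe_nnreal, mul_comm,
            ENNReal.coe_mul]
      _ ≤ _ := setLIntegral_mono' measurableSet_Ioc fun r hr =>
          hmono (NNReal.le_toNNReal_of_coe_le hr.1.le)
  calc A (c * s) = c * A (c * s) + d * A (c * s) := by
        rw [← add_mul, ← ENNReal.coe_add, ← hd, ENNReal.coe_one, one_mul]
    _ ≤ c * A (c * s) + d * (c * s * a (c * s)) := by gcongr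
    _ = c * (A (c * s) + d * s * a (c * s)) := by ring
    _ ≤ c * A s := by gcongr

theorem IsYoung.exists_lt_top (hA : IsYoung A) : ∃ s, 0 < s ∧ A s < ∞ := by
  obtain ⟨a, -, hmono, -, -, ⟨r, hr, har⟩, h⟩ := hA
  refine ⟨r, hr, ?_⟩
  rw [h]
  calc ∫⁻ x in Ioc (0 : ℝ) r, a x.toNNReal ≤ ∫⁻ _ in Ioc (0 : ℝ) r, a r :=
        setLIntegral_mono' measurableSet_Ioc fun x hx => hmono (Real.toNNReal_le_iff_le_coe.2 hx.2)
    _ < ∞ := by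
        rw [setLIntegral_const, Real.volume_Ioc]
        exact ENNReal.mul_lt_top har.lt_top ENNReal.ofReal_lt_top

theorem IsYoung.exists_pos (hA : IsYoung A) : ∃ s, 0 < A s := by
  obtain ⟨a, -, hmono, -, ⟨r, hr, har⟩, -, h⟩ := hA
  refine ⟨r + r, ?_⟩
  rw [h]
  calc 0 < ∫⁻ _ in Ioc (r : ℝ) (r + r : ℝ≥0), a r := by
        rw [setLIntegral_const, Real.volume_Ioc]
        refine ENNReal.mul_pos har (ENNReal.ofReal_pos.2 ?_).ne'
        simpa using hr
    _ ≤ ∫⁻ x in Ioc (r : ℝ) (r + r : ℝ≥0), a x.toNNReal :=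
        setLIntegral_mono' measurableSet_Ioc fun x hx => hmono (NNReal.le_toNNReal_of_coe_le hx.1.le)
    _ ≤ _ := lintegral_mono_set (Ioc_subset_Ioc_left r.2)

theorem IsYoung.exists_gt (hA : IsYoung A) (r : ℝ≥0) : ∃ s, (r : ℝ≥0∞) < A s := by
  obtain ⟨s, hs⟩ := hA.exists_pos
  obtain ⟨k, hk⟩ := ENNReal.exists_nat_mul_gt hs.ne' (ENNReal.coe_ne_top (r := r))
  rcases Nat.eq_zero_or_pos k with rfl | hk0
  · simp at hk
  have hk1 : (k : ℝ≥0) ≠ 0 := by exact_mod_cast hk0.ne'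
  refine ⟨k * s, hk.trans_le ?_⟩
  have h := hA.map_mul_le (c := (k : ℝ≥0)⁻¹)
    (inv_le_one_of_one_le₀ (by exact_mod_cast hk0)) (k * s)
  rw [inv_mul_cancel_left₀ hk1, ENNReal.coe_inv hk1] at h
  calc (k : ℝ≥0∞) * A s ≤ k * (((k : ℝ≥0) : ℝ≥0∞)⁻¹ * A (k * s)) := by gcongr
    _ = A (k * s) := by
      rw [← mul_assoc, ENNReal.coe_natCast, ENNReal.mul_inv_cancel (by exact_mod_cast hk0.ne')
        (ENNReal.natCast_ne_top k), one_mul]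

theorem rightInv_le {r s : ℝ≥0} (h : (r : ℝ≥0∞) < A s) : rightInv A r ≤ s :=
  iInf₂_le s h

theorem lt_of_rightInv_lt (hA : Monotone A) {r s : ℝ≥0} (h : rightInv A r < s) :
    (r : ℝ≥0∞) < A s := by
  simp only [rightInv, iInf_lt_iff] at h
  obtain ⟨τ, hτ, hlt⟩ := h
  exact hτ.trans_le (hA (by exact_mod_cast hlt.le))

theorem le_of_lt_rightInv {r s : ℝ≥0} (h : (s : ℝ≥0∞) < rightInv A r) : A s ≤ r :=
  not_lt.1 fun hlt => (rightInv_le hlt).not_gt h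

theorem le_rightInv_of_le (hA : Monotone A) {r s : ℝ≥0} (h : A s ≤ r) :
    (s : ℝ≥0∞) ≤ rightInv A r :=
  le_of_not_gt fun hlt => (lt_of_rightInv_lt hA hlt).not_ge h

theorem rightInv_mono {r s : ℝ≥0} (h : r ≤ s) : rightInv A r ≤ rightInv A s :=
  le_iInf₂ fun _ hτ => rightInv_le ((ENNReal.coe_le_coe.2 h).trans_lt hτ)

theorem IsYoung.rightInv_lt_top (hA : IsYoung A) (r : ℝ≥0) : rightInv A r < ∞ := by
  obtain ⟨s, hs⟩ := hA.exists_gt r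
  exact (rightInv_le hs).trans_lt ENNReal.coe_lt_top

theorem IsYoung.rightInv_pos (hA : IsYoung A) {r : ℝ≥0} (hr : 0 < r) : 0 < rightInv A r := by
  obtain ⟨s, hs, hAs⟩ := hA.exists_lt_top
  lift A s to ℝ≥0 using hAs.ne with b hb
  set c : ℝ≥0 := min 1 (r / (b + 1)) with hc
  have hc0 : 0 < c := lt_min one_pos (by positivity)
  have h : A (c * s) ≤ r := by
    refine (hA.map_mul_le (min_le_left _ _) s).trans ?_
    rw [← hb, ← ENNReal.coe_mul, ENNReal.coe_le_coe]
    calc c * b ≤ r / (b + 1) * (b + 1) := by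
          gcongr
          · exact min_le_right _ _
          · exact le_self_add
      _ = r := div_mul_cancel₀ _ (by positivity)
  exact (ENNReal.coe_pos.2 (mul_pos hc0 hs)).trans_le (le_rightInv_of_le hA.monotone h)

theorem IsYoung.rightInv_two_mul_le (hA : IsYoung A) (r : ℝ≥0) :
    rightInv A (2 * r) ≤ 2 * rightInv A r := by
  rw [mul_comm (2 : ℝ≥0∞), ← ENNReal.div_le_iff two_ne_zero ENNReal.ofNat_ne_top]
  refine le_iInf₂ fun τ hτ => ?_
  rw [ENNReal.div_le_iff two_ne_zero ENNReal.ofNat_ne_top]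
  have h := hA.map_mul_le (c := 2⁻¹) (inv_le_one_of_one_le₀ one_le_two) (2 * τ)
  rw [inv_mul_cancel_left₀ two_ne_zero, ENNReal.coe_inv two_ne_zero, ENNReal.coe_ofNat] at h
  have h2 : ((2 * r : ℝ≥0) : ℝ≥0∞) < A (2 * τ) := by
    calc ((2 * r : ℝ≥0) : ℝ≥0∞) = 2 * r := by simp
      _ < 2 * A τ := (ENNReal.mul_lt_mul_iff_right two_ne_zero ENNReal.ofNat_ne_top).2 hτ
      _ ≤ 2 * (2⁻¹ * A (2 * τ)) := by gcongr
      _ = A (2 * τ) := by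
        rw [← mul_assoc, ENNReal.mul_inv_cancel two_ne_zero ENNReal.ofNat_ne_top, one_mul]
  exact (rightInv_le h2).trans_eq (by push_cast; ring)

/-- The inverse of a Young function is finite, so it can be read in `ℝ≥0`. -/
noncomputable def nnInv (A : ℝ≥0 → ℝ≥0∞) (r : ℝ≥0) : ℝ≥0 := (rightInv A r).toNNReal

theorem IsYoung.coe_nnInv (hA : IsYoung A) (r : ℝ≥0) : (nnInv A r : ℝ≥0∞) = rightInv A r :=
  ENNReal.coe_toNNReal (hA.rightInv_lt_top r).ne

theorem IsYoung.nnInv_pos (hA : IsYoung A) {r : ℝ≥0} (hr : 0 < r) : 0 < nnInv A r := by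
  rw [← ENNReal.coe_pos, hA.coe_nnInv]
  exact hA.rightInv_pos hr

theorem IsYoung.nnInv_mono (hA : IsYoung A) : Monotone (nnInv A) := fun r s h => by
  rw [← ENNReal.coe_le_coe, hA.coe_nnInv, hA.coe_nnInv]
  exact rightInv_mono h

theorem IsYoung.nnInv_two_mul_le (hA : IsYoung A) (r : ℝ≥0) :
    nnInv A (2 * r) ≤ 2 * nnInv A r := by
  rw [← ENNReal.coe_le_coe, ENNReal.coe_mul, hA.coe_nnInv, hA.coe_nnInv]
  exact_mod_cast hA.rightInv_two_mul_le r

end Young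

/-! ### Growth of the optimal target under the Boyd index condition -/

section Boyd

variable {A : ℝ≥0 → ℝ≥0∞} {n m : ℕ}

/-- The Boyd index condition provides one scale `t < 1` at which `A⁻¹ (s t) / A⁻¹ s` is eventually
below `t ^ (m / n)` by a fixed factor. -/
theorem exists_rightInv_mul_le (hA : IsYoung A) (hm : 1 ≤ m) (hmn : m < n)
    (hI : upperBoydIndex A < (n : ℝ≥0∞) / (m : ℝ≥0∞)) :
    ∃ t q s₀ : ℝ≥0, 0 < t ∧ t < 1 ∧ q < t ^ ((m : ℝ) / n) ∧ 0 < s₀ ∧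
      ∀ s, s₀ ≤ s → nnInv A (s * t) ≤ q * nnInv A s := by
  have hm0 : (m : ℝ≥0∞) ≠ 0 := by exact_mod_cast (by omega : m ≠ 0)
  have hn0 : (n : ℝ≥0∞) ≠ 0 := by exact_mod_cast (by omega : n ≠ 0)
  simp only [upperBoydIndex, iInf_lt_iff] at hI
  obtain ⟨t, ⟨ht0, ht1⟩, ht⟩ := hI
  have hlt : boydFun A t < (t : ℝ≥0∞) ^ ((m : ℝ) / n) := by
    by_contra hcon
    refine ht.not_ge ?_
    have hlog : (-(ENNReal.log (boydFun A t))).toENNReal ≤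
        (m / n : ℝ≥0∞) * (-(ENNReal.log (t : ℝ≥0∞))).toENNReal := by
      have h1 := ENNReal.log_monotone (not_lt.1 hcon)
      rw [ENNReal.log_rpow] at h1
      have h2 := EReal.toENNReal_le_toENNReal (EReal.neg_le_neg_iff.2 h1)
      refine h2.trans_eq ?_
      have h3 : (((m : ℝ) / n : ℝ) : EReal).toENNReal = (m / n : ℝ≥0∞) := by
        rw [EReal.toENNReal_of_ne_top (EReal.coe_ne_top _), EReal.toReal_coe,
          ENNReal.ofReal_div_of_pos (by exact_mod_cast (by omega : 0 < n)),
          ENNReal.ofReal_natCast, ENNReal.ofReal_natCast]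
      rw [← mul_neg, EReal.toENNReal_mul (by exact_mod_cast (by positivity)), h3]
    have hlt0 : (-(ENNReal.log (t : ℝ≥0∞))).toENNReal ≠ 0 := by
      rw [Ne, EReal.toENNReal_eq_zero_iff, not_le]
      have : ENNReal.log (t : ℝ≥0∞) < 0 := ENNReal.log_lt_zero_iff.2 (by exact_mod_cast ht1)
      exact EReal.neg_pos.2 this |>.trans_le le_rfl
    have hltt : (-(ENNReal.log (t : ℝ≥0∞))).toENNReal ≠ ∞ := by
      rw [Ne, EReal.toENNReal_eq_top_iff, EReal.neg_eq_top_iff, ENNReal.log_eq_bot_iff]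
      exact_mod_cast ht0.ne'
    rw [ENNReal.le_div_iff_mul_le (Or.inr hlt0) (Or.inr hltt)]
    calc (n / m : ℝ≥0∞) * (-(ENNReal.log (boydFun A t))).toENNReal
        ≤ (n / m : ℝ≥0∞) * ((m / n : ℝ≥0∞) * (-(ENNReal.log (t : ℝ≥0∞))).toENNReal) := by gcongr
      _ = (-(ENNReal.log (t : ℝ≥0∞))).toENNReal := by
        rw [← mul_assoc, ← ENNReal.inv_div (Or.inl (ENNReal.natCast_ne_top n)) (Or.inl hn0),
          ENNReal.inv_mul_cancel, one_mul]
        · exact (ENNReal.div_pos hm0 (ENNReal.natCast_ne_top n)).ne'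
        · exact ENNReal.div_ne_top (ENNReal.natCast_ne_top m) hn0
  obtain ⟨q, hq1, hq2⟩ := ENNReal.lt_iff_exists_nnreal_btwn.1 hlt
  have hev := eventually_lt_of_limsup_lt hq1
  obtain ⟨s₁, hs₁⟩ := eventually_atTop.1 hev
  refine ⟨t, q, max s₁ 1, ht0, ht1, ?_, lt_max_of_lt_right one_pos, fun s hs => ?_⟩
  · rw [← ENNReal.coe_lt_coe, ENNReal.coe_rpow_of_ne_zero ht0.ne']
    exact hq2
  · have hs0 : 0 < s := one_pos.trans_le ((le_max_right _ _).trans hs)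
    have h := (hs₁ s ((le_max_left _ _).trans hs)).le
    rw [ENNReal.div_le_iff (hA.rightInv_pos hs0).ne' (hA.rightInv_lt_top s).ne,
      ← hA.coe_nnInv, ← hA.coe_nnInv] at h
    exact_mod_cast h

/-- If `f` grows by at most `C ψ` between `s t` and `s`, while `ψ` decays geometrically along
`s, s t, s t ^ 2, …`, then `f` is dominated by a multiple of `ψ`. -/
theorem exists_le_mul_of_recursion {f : ℝ≥0 → ℝ≥0∞} {ψ : ℝ≥0 → ℝ≥0} {t κ C b s₀ : ℝ≥0}
    (ht1 : t < 1) (hκ : κ < 1) (hs₀ : 0 < s₀) (hf : Monotone f) (hfin : f s₀ < ∞)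
    (hrec : ∀ s, s₀ ≤ s → f s ≤ f (s * t) + (C * ψ s : ℝ≥0))
    (hψ : ∀ s, s₀ ≤ s → ψ (s * t) ≤ κ * ψ s) (hb : 0 < b)
    (hbψ : ∀ s, s₀ * t ≤ s → s ≤ s₀ → b ≤ ψ s) :
    ∃ K : ℝ≥0, ∀ s, s₀ ≤ s → f s ≤ (K * ψ s : ℝ≥0) := by
  lift f s₀ to ℝ≥0 using hfin.ne with F hF
  obtain ⟨d, hd⟩ := exists_add_of_le hκ.le
  have hd0 : 0 < d := by
    rcases eq_or_ne d 0 with rfl | h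
    · rw [add_zero] at hd; exact absurd hd hκ.ne'
    · exact pos_iff_ne_zero.2 h
  set K : ℝ≥0 := F / b + C / d with hK
  have hKstep : K * κ + C ≤ K := by
    calc K * κ + C = K * κ + C / d * d := by rw [div_mul_cancel₀ _ hd0.ne']
      _ ≤ K * κ + K * d := by gcongr; exact le_add_self
      _ = K := by rw [← mul_add, ← hd, mul_one]
  have key : ∀ k : ℕ, ∀ s, s₀ * t ≤ s → s * t ^ k ≤ s₀ → f s ≤ (K * ψ s : ℝ≥0) := by
    intro k
    have base : ∀ s, s₀ * t ≤ s → s ≤ s₀ → f s ≤ (K * ψ s : ℝ≥0) := by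
      intro s h1 h2
      refine (hf h2).trans ?_
      rw [← hF, ENNReal.coe_le_coe]
      calc F = F / b * b := (div_mul_cancel₀ _ hb.ne').symm
        _ ≤ K * ψ s := by gcongr; exacts [le_self_add, hbψ s h1 h2]
    induction k with
    | zero => intro s h1 h2; exact base s h1 (by simpa using h2)
    | succ k ih =>
      intro s h1 h2
      rcases le_total s s₀ with hs | hs
      · exact base s h1 hs
      refine (hrec s hs).trans ?_
      have h3 := ih (s * t) (by gcongr) (by rwa [pow_succ', ← mul_assoc] at h2)
      calc f (s * t) + (C * ψ s : ℝ≥0)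
          ≤ (K * ψ (s * t) : ℝ≥0) + (C * ψ s : ℝ≥0) := by gcongr
        _ ≤ (K * ψ s : ℝ≥0) := by
          rw [← ENNReal.coe_add, ENNReal.coe_le_coe]
          calc K * ψ (s * t) + C * ψ s ≤ K * (κ * ψ s) + C * ψ s := by gcongr; exact hψ s hs
            _ = (K * κ + C) * ψ s := by ring
            _ ≤ K * ψ s := by gcongr
  refine ⟨K, fun s hs => ?_⟩
  have hspos : 0 < s := hs₀.trans_le hs
  obtain ⟨k, hk⟩ := exists_pow_lt_of_lt_one (div_pos hs₀ hspos) ht1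
  refine key k s ((mul_le_of_le_one_right' ht1.le).trans hs) ?_
  rw [mul_comm]
  exact ((lt_div_iff₀ hspos).1 hk).le

theorem subcritIntegral_mono : Monotone (subcritIntegral n m A) := fun r s h =>
  lintegral_mono_set (Ioc_subset_Ioc_right (by exact_mod_cast h))

theorem subcritIntegral_le_add (r₀ r : ℝ≥0) (hmn : m < n) {b : ℝ≥0} (hb : 0 < b)
    (h : ∀ τ : ℝ≥0, r₀ < τ → τ ≤ r → (b : ℝ≥0∞) ≤ A τ) :
    subcritIntegral n m A r ≤ subcritIntegral n m A r₀ +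
      (r * (r / b) ^ ((m : ℝ) / ((n : ℝ) - m)) : ℝ≥0) := by
  have hp : 0 ≤ (m : ℝ) / ((n : ℝ) - m) := by
    have : (m : ℝ) < n := by exact_mod_cast hmn
    exact div_nonneg (by positivity) (by linarith)
  set p := (m : ℝ) / ((n : ℝ) - m) with hpdef
  have hsub : Ioc (0 : ℝ) r ⊆ Ioc (0 : ℝ) r₀ ∪ Ioc (r₀ : ℝ) r := fun x hx =>
    (le_or_gt x r₀).imp (fun h => ⟨hx.1, h⟩) fun h => ⟨h, hx.2⟩
  refine (lintegral_mono_set hsub).trans ((lintegral_union_le _ _ _).trans ?_)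
  refine add_le_add le_rfl ?_
  calc ∫⁻ x in Ioc (r₀ : ℝ) r, (ENNReal.ofReal x / A x.toNNReal) ^ p
      ≤ ∫⁻ _ in Ioc (r₀ : ℝ) r, ((r : ℝ≥0∞) / b) ^ p := by
        refine setLIntegral_mono' measurableSet_Ioc fun x hx => ?_
        refine ENNReal.rpow_le_rpow (ENNReal.div_le_div ?_ ?_) hp
        · exact (ENNReal.ofReal_le_ofReal hx.2).trans_eq (ENNReal.ofReal_coe_nnreal)
        · exact h _ (Real.lt_toNNReal_iff_coe_lt.2 hx.1) (Real.toNNReal_le_iff_le_coe.2 hx.2)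
    _ ≤ ((r : ℝ≥0∞) / b) ^ p * r := by
        rw [setLIntegral_const, Real.volume_Ioc]
        gcongr
        exact (ENNReal.ofReal_le_ofReal (sub_le_self _ r₀.2)).trans_eq ENNReal.ofReal_coe_nnreal
    _ = _ := by
        rw [ENNReal.coe_mul, ENNReal.coe_rpow_of_nonneg _ hp, ENNReal.coe_div hb.ne', mul_comm]

theorem subcritIntegral_lt_top (hA : Monotone A) (hm : 1 ≤ m) (hmn : m < n)
    (hfin : ∃ δ : ℝ≥0, 0 < δ ∧ subcritIntegral n m A δ < ∞) (r : ℝ≥0) :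
    subcritIntegral n m A r < ∞ := by
  obtain ⟨δ, hδ, hδfin⟩ := hfin
  have hp : 0 < (m : ℝ) / ((n : ℝ) - m) := by
    have : (m : ℝ) < n := by exact_mod_cast hmn
    exact div_pos (by exact_mod_cast hm) (by linarith)
  have hAδ : 0 < A δ := by
    by_contra h0
    refine hδfin.ne ?_
    calc subcritIntegral n m A δ = ∫⁻ _ in Ioc (0 : ℝ) δ, ∞ := by
          refine setLIntegral_congr_fun measurableSet_Ioc fun x hx => ?_
          have : A x.toNNReal = 0 := le_antisymm
            ((hA (Real.toNNReal_le_iff_le_coe.2 hx.2)).trans (not_lt.1 h0)) zero_le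
          simp only [this]
          rw [ENNReal.div_zero (ENNReal.ofReal_pos.2 hx.1).ne', ENNReal.top_rpow_of_pos hp]
      _ = ∞ := by
          rw [setLIntegral_const, Real.volume_Ioc, sub_zero, ENNReal.ofReal_coe_nnreal,
            ENNReal.top_mul (by exact_mod_cast hδ.ne')]
  obtain ⟨b, hb0, hb⟩ := ENNReal.lt_iff_exists_nnreal_btwn.1 hAδ
  refine (subcritIntegral_le_add δ r hmn (b := b) (by exact_mod_cast hb0)
    fun τ hτ _ => hb.le.trans (hA hτ.le)).trans_lt ?_
  exact ENNReal.add_lt_top.2 ⟨hδfin, ENNReal.coe_lt_top⟩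

/-- Under the Boyd index condition `H (2 A⁻¹ s)` is at most a multiple of `A⁻¹ s * s ^ (-m / n)`
for large `s`. -/
theorem exists_cianchiH_le (hA : IsYoung A) (hm : 1 ≤ m) (hmn : m < n)
    (hfin : ∃ δ : ℝ≥0, 0 < δ ∧ subcritIntegral n m A δ < ∞)
    (hI : upperBoydIndex A < (n : ℝ≥0∞) / (m : ℝ≥0∞)) :
    ∃ K s₀ : ℝ≥0, 0 < s₀ ∧ ∀ s, s₀ ≤ s →
      cianchiH n m A (2 * nnInv A s) ≤ (K * (nnInv A s / s ^ ((m : ℝ) / n)) : ℝ≥0) := by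
  obtain ⟨t, q, s₀, ht0, ht1, hq, hs₀, hG⟩ := exists_rightInv_mul_le hA hm hmn hI
  have hmR : (0 : ℝ) < m := by exact_mod_cast hm
  have hnmR : (0 : ℝ) < (n : ℝ) - m := by
    have : (m : ℝ) < n := by exact_mod_cast hmn
    linarith
  have hnR : (0 : ℝ) < n := by linarith
  set p : ℝ := (m : ℝ) / ((n : ℝ) - m) with hp
  have hp0 : 0 < p := div_pos hmR hnmR
  have hp1 : 0 < 1 + p := by linarith
  have hpe : (m : ℝ) / n * (1 + p) = p := by rw [hp]; field_simp; ring
  set g := nnInv A with hg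
  set ψ : ℝ≥0 → ℝ≥0 := fun s => g s ^ (1 + p) / s ^ p with hψ
  have htp : 0 < t ^ p := NNReal.rpow_pos ht0
  have hκ : q ^ (1 + p) / t ^ p < 1 := by
    have h := NNReal.rpow_lt_rpow hq hp1
    rwa [← NNReal.rpow_mul, hpe, ← div_lt_one htp] at h
  have hdom : ∃ K : ℝ≥0, ∀ s, s₀ ≤ s → subcritIntegral n m A (2 * g s) ≤ (K * ψ s : ℝ≥0) := by
    refine exists_le_mul_of_recursion
      (f := fun s => subcritIntegral n m A (2 * g s)) (ψ := ψ) (t := t)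
      (κ := q ^ (1 + p) / t ^ p) (C := 2 ^ (1 + p) / t ^ p)
      (b := g (s₀ * t) ^ (1 + p) / s₀ ^ p) (s₀ := s₀) ht1 hκ hs₀
      (fun r s h => subcritIntegral_mono (mul_le_mul_right (hA.nnInv_mono h) _))
      (subcritIntegral_lt_top hA.monotone hm hmn hfin _) ?_ ?_ ?_ ?_
    · intro s hs
      have hs0 : 0 < s := hs₀.trans_le hs
      refine (subcritIntegral_le_add (2 * g (s * t)) (2 * g s) hmn (b := s * t) (mul_pos hs0 ht0)
        fun τ hτ _ => ?_).trans_eq ?_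
      · refine (lt_of_rightInv_lt hA.monotone ?_).le
        rw [← hA.coe_nnInv, ENNReal.coe_lt_coe]
        exact lt_of_le_of_lt (le_mul_of_one_le_left' one_le_two) hτ
      · congr 2
        rw [← hp, NNReal.div_rpow, NNReal.mul_rpow (x := s) (y := t), hψ]
        simp only
        rw [← mul_div_assoc, ← NNReal.rpow_one_add' hp1.ne', NNReal.mul_rpow, div_mul_div_comm,
          mul_comm (t ^ p)]
    · intro s hs
      have hs0 : 0 < s := hs₀.trans_le hs
      simp only [hψ]
      calc g (s * t) ^ (1 + p) / (s * t) ^ p ≤ (q * g s) ^ (1 + p) / (s * t) ^ p := by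
            gcongr
            exact hG s hs
        _ = q ^ (1 + p) / t ^ p * (g s ^ (1 + p) / s ^ p) := by
            rw [NNReal.mul_rpow, NNReal.mul_rpow, div_mul_div_comm, mul_comm (t ^ p)]
    · exact div_pos (NNReal.rpow_pos (hA.nnInv_pos (mul_pos hs₀ ht0))) (NNReal.rpow_pos hs₀)
    · intro s h1 h2
      simp only [hψ]
      have hs0 : 0 < s := (mul_pos hs₀ ht0).trans_le h1
      have : 0 < s ^ p := NNReal.rpow_pos hs0
      gcongr
      exact hA.nnInv_mono h1
  obtain ⟨K, hK⟩ := hdom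
  refine ⟨K ^ (((n : ℝ) - m) / n), s₀, hs₀, fun s hs => ?_⟩
  have he : 0 ≤ ((n : ℝ) - m) / n := (div_pos hnmR hnR).le
  refine (ENNReal.rpow_le_rpow (hK s hs) he).trans_eq ?_
  rw [← ENNReal.coe_rpow_of_nonneg _ he, NNReal.mul_rpow, NNReal.div_rpow, ← NNReal.rpow_mul,
    ← NNReal.rpow_mul]
  have e1 : (1 + p) * (((n : ℝ) - m) / n) = 1 := by rw [hp]; field_simp; ring
  have e2 : p * (((n : ℝ) - m) / n) = (m : ℝ) / n := by rw [hp]; field_simp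
  rw [e1, e2, NNReal.rpow_one]

end Boyd

end OrliczSobolev

namespace OrliczSobolev

/-! ### Luxemburg norms of test functions -/

section Luxemburg

variable {n m : ℕ} {A : ℝ≥0 → ℝ≥0∞} {Ω S : Set (EuclideanSpace ℝ (Fin n))}
  {f g : EuclideanSpace ℝ (Fin n) → ℝ}

theorem modular_congr_ae (h : f =ᵐ[volume.restrict Ω] g) (lam : ℝ≥0) :
    modular A Ω f lam = modular A Ω g lam :=
  lintegral_congr_ae (h.mono fun x hx => by simp only [hx])

theorem modular_le_of_support (hA : Monotone A) (hA0 : A 0 = 0) (hS : MeasurableSet S) {M : ℝ≥0}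
    (hM : ∀ x, ‖f x‖₊ ≤ M) (hf : ∀ x, x ∉ S → f x = 0) (lam : ℝ≥0) :
    modular A Ω f lam ≤ A (M / lam) * volume (S ∩ Ω) := by
  calc ∫⁻ x in Ω, A (‖f x‖₊ / lam)
      ≤ ∫⁻ x in Ω, S.indicator (fun _ => A (M / lam)) x := by
        refine lintegral_mono fun x => ?_
        by_cases hx : x ∈ S
        · rw [indicator_of_mem hx]
          exact hA (by gcongr; exact hM x)
        · rw [hf x hx]; simp [hA0]
    _ = A (M / lam) * volume (S ∩ Ω) := by
        rw [lintegral_indicator_const hS, Measure.restrict_apply hS]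

/-- The threshold `2 * M / A⁻¹ (1 / V)` for a function bounded by `M` on a set of measure `V`. -/
theorem modular_le_one (hA : IsYoung A) (hS : MeasurableSet S) {M V : ℝ≥0} (hM0 : 0 < M)
    (hM : ∀ x, ‖f x‖₊ ≤ M) (hf : ∀ x, x ∉ S → f x = 0) (hV0 : 0 < V)
    (hV : volume (S ∩ Ω) = V) : modular A Ω f (2 * M / nnInv A V⁻¹) ≤ 1 := by
  refine (modular_le_of_support hA.monotone hA.map_zero hS hM hf _).trans ?_
  have hg : 0 < nnInv A V⁻¹ := hA.nnInv_pos (inv_pos.2 hV0)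
  have e : M / (2 * M / nnInv A V⁻¹) = nnInv A V⁻¹ / 2 := by
    have := hM0.ne'
    have := hg.ne'
    field_simp
  have h : A (nnInv A V⁻¹ / 2) ≤ (V⁻¹ : ℝ≥0) := by
    refine le_of_lt_rightInv ?_
    rw [← hA.coe_nnInv, ENNReal.coe_lt_coe]
    exact NNReal.half_lt_self hg.ne'
  rw [e, hV]
  calc A (nnInv A V⁻¹ / 2) * V ≤ (V⁻¹ : ℝ≥0) * V := by gcongr
    _ = 1 := by rw [← ENNReal.coe_mul, inv_mul_cancel₀ hV0.ne', ENNReal.coe_one]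

theorem luxNorm_le_of_ae_eq (hA : IsYoung A) (hS : MeasurableSet S) {M V : ℝ≥0} (hM0 : 0 < M)
    (hM : ∀ x, ‖f x‖₊ ≤ M) (hf : ∀ x, x ∉ S → f x = 0) (hV0 : 0 < V)
    (hV : volume (S ∩ Ω) = V) (hg : g =ᵐ[volume.restrict Ω] f) :
    luxNorm A Ω g ≤ (2 * M / nnInv A V⁻¹ : ℝ≥0) := by
  refine iInf₂_le (2 * M / nnInv A V⁻¹) ⟨?_, ?_⟩
  · exact div_pos (mul_pos two_pos hM0) (hA.nnInv_pos (inv_pos.2 hV0))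
  · rw [modular_congr_ae hg]
    exact modular_le_one hA hS hM0 hM hf hV0 hV

theorem memOrlicz_of_ae_eq (hA : IsYoung A) (hS : MeasurableSet S) {M V : ℝ≥0} (hM0 : 0 < M)
    (hM : ∀ x, ‖f x‖₊ ≤ M) (hf : ∀ x, x ∉ S → f x = 0) (hV0 : 0 < V)
    (hV : volume (S ∩ Ω) = V) (hmeas : Measurable f) (hg : g =ᵐ[volume.restrict Ω] f) :
    MemOrlicz A Ω g := by
  refine ⟨⟨f, hmeas, hg⟩, 2 * M / nnInv A V⁻¹, ?_, ?_⟩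
  · exact div_pos (mul_pos two_pos hM0) (hA.nnInv_pos (inv_pos.2 hV0))
  · rw [modular_congr_ae hg]
    exact (modular_le_one hA hS hM0 hM hf hV0 hV).trans_lt ENNReal.one_lt_top

theorem cianchiH_mono (hmn : m < n) : Monotone (cianchiH n m A) := fun r s h => by
  have : (m : ℝ) < n := by exact_mod_cast hmn
  exact ENNReal.rpow_le_rpow (subcritIntegral_mono h)
    (div_nonneg (by linarith) (by positivity))

/-- A function equal to `1` on a set of measure at least `1 / s` has norm at least
`1 / H (2 A⁻¹ s)` in `L^{A_{n/m}}`. With `A_{n/m}⁻¹ = H ∘ A⁻¹` one expects this without the factor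
`2`, which avoids the question whether the infimum defining the inverse of `H` is attained. -/
theorem le_luxNorm_sobolevConj (hA : IsYoung A) (hmn : m < n) (hS : MeasurableSet S)
    (hf : ∀ x ∈ S, f x = 1) {s X : ℝ≥0} (hs : 0 < s) (hv : (s : ℝ≥0∞)⁻¹ ≤ volume (S ∩ Ω))
    (hX : cianchiH n m A (2 * nnInv A s) ≤ X) :
    (X : ℝ≥0∞)⁻¹ ≤ luxNorm (sobolevConj n m A) Ω f := by
  refine le_iInf₂ fun lam ⟨hlam, hmod⟩ => ?_
  have h1 : sobolevConj n m A lam⁻¹ * volume (S ∩ Ω) ≤ 1 := by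
    refine le_trans ?_ hmod
    calc sobolevConj n m A lam⁻¹ * volume (S ∩ Ω)
        = ∫⁻ x in Ω, S.indicator (fun _ => sobolevConj n m A lam⁻¹) x := by
          rw [lintegral_indicator_const hS, Measure.restrict_apply hS]
      _ ≤ ∫⁻ x in Ω, sobolevConj n m A (‖f x‖₊ / lam) := by
          refine lintegral_mono fun x => ?_
          by_cases hx : x ∈ S
          · rw [indicator_of_mem hx, hf x hx, nnnorm_one, one_div]
          · rw [indicator_of_notMem hx]; exact zero_le
  have hs' : (s : ℝ≥0∞) ≠ 0 := ENNReal.coe_ne_zero.2 hs.ne'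
  have h2 : sobolevConj n m A lam⁻¹ ≤ s := by
    calc sobolevConj n m A lam⁻¹ = sobolevConj n m A lam⁻¹ * (s : ℝ≥0∞)⁻¹ * s := by
          rw [mul_assoc, ENNReal.inv_mul_cancel hs' ENNReal.coe_ne_top, mul_one]
      _ ≤ sobolevConj n m A lam⁻¹ * volume (S ∩ Ω) * s := by gcongr
      _ ≤ 1 * s := by gcongr
      _ = s := one_mul _
  have h3 : leftInv (cianchiH n m A) lam⁻¹ < (2 * nnInv A s : ℝ≥0) := by
    unfold sobolevConj extendTop at h2
    split_ifs at h2 with htop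
    · exact absurd h2 (by simp)
    · have h4 := le_rightInv_of_le hA.monotone h2
      rw [ENNReal.coe_toNNReal htop, ← hA.coe_nnInv] at h4
      refine h4.trans_lt (ENNReal.coe_lt_coe.2 ?_)
      exact lt_mul_of_one_lt_left (hA.nnInv_pos hs) one_lt_two
  simp only [leftInv, iInf_lt_iff] at h3
  obtain ⟨r, hr, hlt⟩ := h3
  have h5 : ((lam⁻¹ : ℝ≥0) : ℝ≥0∞) ≤ X :=
    hr.trans ((cianchiH_mono hmn (by exact_mod_cast hlt.le)).trans hX)
  rw [ENNReal.coe_inv hlam.ne'] at h5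
  exact ENNReal.inv_le_iff_inv_le.1 h5

end Luxemburg

/-! ### Consequences of the embedding -/

section Gap

variable {n m : ℕ} {A : ℝ≥0 → ℝ≥0∞} {Ω : Set (EuclideanSpace ℝ (Fin n))}

/-- The cutoff between the cubes of half side `r` and `r + ρ` is admissible in the embedding, and
its Sobolev norm is at most a multiple of `ρ ^ (-m) / A⁻¹ (1 / V)`, where `V` is the measure of the
part of `Ω` in a slightly larger cube. -/
theorem exists_testFunction (hA : IsYoung A) (m : ℕ) (hΩ : IsOpen Ω) :
    ∃ D : ℝ≥0, ∀ (x : EuclideanSpace ℝ (Fin n)) (r R : ℝ) (ρ V : ℝ≥0), 0 < ρ → ρ ≤ 1 →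
      r + ρ < R → 0 < V → volume (cube x R ∩ Ω) = V →
      ∃ u : EuclideanSpace ℝ (Fin n) → ℝ, MemSobolev m A Ω u ∧ (∀ y ∈ cube x r, u y = 1) ∧
        sobolevNorm m A Ω u ≤ (D / (ρ ^ m * nnInv A V⁻¹) : ℝ≥0) := by
  obtain ⟨C, hC⟩ := exists_cutoff n
  set D₀ : ℝ≥0 := 1 + ∑ k ∈ Finset.range (m + 1), ‖C k‖₊ with hD₀
  have hD₀C : ∀ k ≤ m, C k ≤ D₀ := by
    intro k hk
    have h1 : ‖C k‖₊ ≤ D₀ := (Finset.single_le_sum (f := fun k => ‖C k‖₊) (fun _ _ => zero_le)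
      (Finset.mem_range.2 (Nat.lt_succ_of_le hk))).trans le_add_self
    exact (le_abs_self _).trans (by exact_mod_cast h1)
  refine ⟨(multiIndices n m).card * (2 * D₀), fun x r R ρ V hρ0 hρ1 hrR hV0 hV => ?_⟩
  obtain ⟨u, ⟨hu, hub⟩, hu1, husupp⟩ := hC x r ρ (by exact_mod_cast hρ0)
  set M : ℝ≥0 := D₀ / ρ ^ m with hM
  have hM0 : 0 < M := by positivity
  have hS : MeasurableSet (cube x R) := (isOpen_cube x R).measurableSet
  have hbound : ∀ l : List (Fin n), l.length ≤ m → ∀ y, ‖listDeriv l u y‖₊ ≤ M := by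
    intro l hl y
    rw [← NNReal.coe_le_coe, coe_nnnorm, Real.norm_eq_abs]
    refine (abs_listDeriv_le l hu y).trans ((hub _ y).trans ?_)
    rw [hM, NNReal.coe_div, NNReal.coe_pow, div_eq_mul_inv, ← inv_pow]
    have h1 : (1 : ℝ) ≤ (ρ : ℝ)⁻¹ := (one_le_inv₀ (by exact_mod_cast hρ0)).2 (by exact_mod_cast hρ1)
    exact mul_le_mul (hD₀C _ hl) (pow_le_pow_right₀ h1 hl) (by positivity) D₀.2
  have hzero : ∀ l : List (Fin n), ∀ y, y ∉ cube x R → listDeriv l u y = 0 := fun l y hy =>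
    image_eq_zero_of_notMem_tsupport fun h => hy (husupp R hrR (tsupport_listDeriv_subset l h))
  have hlen : ∀ α : Fin n → ℕ, ∑ i, α i ≤ m → (indexList α).reverse.length ≤ m := fun α hα => by
    rwa [List.length_reverse, length_indexList]
  refine ⟨u, ⟨?_, fun α hα => ⟨⟨_, isWeakDeriv_listDeriv Ω α hu⟩, ?_⟩⟩, hu1, ?_⟩
  · exact memOrlicz_of_ae_eq hA hS hM0 (hbound [] (Nat.zero_le m)) (hzero []) hV0 hV
      hu.continuous.measurable EventuallyEq.rfl
  · exact memOrlicz_of_ae_eq hA hS hM0 (hbound _ (hlen α hα)) (hzero _) hV0 hV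
      (contDiff_listDeriv _ hu).continuous.measurable (weakDeriv_ae_eq hΩ α hu)
  · calc sobolevNorm m A Ω u ≤ ∑ _α ∈ multiIndices n m, ((2 * M / nnInv A V⁻¹ : ℝ≥0) : ℝ≥0∞) :=
          Finset.sum_le_sum fun α hα => luxNorm_le_of_ae_eq hA hS hM0
            (hbound _ (hlen α (mem_multiIndices.1 hα))) (hzero _) hV0 hV (weakDeriv_ae_eq hΩ α hu)
      _ = _ := by
          rw [Finset.sum_const, nsmul_eq_mul, ← ENNReal.coe_natCast, ← ENNReal.coe_mul, hM]
          congr 1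
          rw [← mul_div_assoc 2 D₀, div_div, mul_div_assoc, mul_div_assoc, mul_div_assoc]

/-- If the embedding holds, two concentric cubes whose traces on `Ω` have comparable small measure
are separated by at most a multiple of that measure to the power `1 / n`. -/
theorem exists_gap_le (hm : 1 ≤ m) (hmn : m < n) (hA : IsYoung A)
    (hfin : ∃ δ : ℝ≥0, 0 < δ ∧ subcritIntegral n m A δ < ∞)
    (hI : upperBoydIndex A < (n : ℝ≥0∞) / (m : ℝ≥0∞)) (hΩ : IsOpen Ω)
    (hemb : ContinuousEmbedding m A (sobolevConj n m A) Ω) :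
    ∃ C v₀ : ℝ≥0, 0 < v₀ ∧ ∀ (x : EuclideanSpace ℝ (Fin n)) (r R : ℝ) (V : ℝ≥0), 0 < r → r < R →
      R ≤ 1 → 0 < V → V ≤ v₀ → volume (cube x R ∩ Ω) = V →
      ((V / 2 : ℝ≥0) : ℝ≥0∞) ≤ volume (cube x r ∩ Ω) → R - r ≤ C * (V : ℝ) ^ (1 / n : ℝ) := by
  obtain ⟨Ce, hCe⟩ := hemb
  obtain ⟨D, hD⟩ := exists_testFunction (n := n) hA m hΩ
  obtain ⟨K, s₀, hs₀, hK⟩ := exists_cianchiH_le hA hm hmn hfin hI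
  set P : ℝ≥0 := 2 * Ce * D * (K + 1) with hP
  refine ⟨2 * P ^ (1 / m : ℝ), 2 / s₀, by positivity, fun x r R V hr hrR hR1 hV0 hVv hV hVr => ?_⟩
  set s : ℝ≥0 := 2 * V⁻¹ with hs
  have hs0 : 0 < s := by positivity
  have hs₀s : s₀ ≤ s := by
    rw [le_div_iff₀ hs₀] at hVv
    rw [hs, ← div_eq_mul_inv, le_div_iff₀ hV0, mul_comm]
    exact hVv
  set ρ : ℝ≥0 := ((R - r) / 2).toNNReal with hρ
  have hρR : (ρ : ℝ) = (R - r) / 2 := Real.coe_toNNReal _ (by linarith)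
  have hρ0 : 0 < ρ := Real.toNNReal_pos.2 (by linarith)
  have hρ1 : ρ ≤ 1 := by rw [← NNReal.coe_le_coe, hρR, NNReal.coe_one]; linarith
  obtain ⟨u, hu, hu1, hnorm⟩ := hD x r R ρ V hρ0 hρ1 (by rw [hρR]; linarith) hV0 hV
  have hg : 0 < nnInv A s := hA.nnInv_pos hs0
  have hg' : 0 < nnInv A V⁻¹ := hA.nnInv_pos (by positivity)
  have hsm : 0 < s ^ ((m : ℝ) / n) := NNReal.rpow_pos hs0
  set X : ℝ≥0 := (K + 1) * (nnInv A s / s ^ ((m : ℝ) / n)) with hX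
  have hX0 : 0 < X := by positivity
  have hlow : (X : ℝ≥0∞)⁻¹ ≤ luxNorm (sobolevConj n m A) Ω u := by
    refine le_luxNorm_sobolevConj hA hmn (isOpen_cube x r).measurableSet hu1 hs0 ?_
      ((hK s hs₀s).trans ?_)
    · rw [← ENNReal.coe_inv hs0.ne', hs, mul_inv, inv_inv, mul_comm, ← div_eq_mul_inv]
      exact hVr
    · rw [hX, ENNReal.coe_le_coe]
      gcongr
      exact le_self_add
  have hmain : X⁻¹ ≤ Ce * (D / (ρ ^ m * nnInv A V⁻¹)) := by
    have h := hlow.trans ((hCe u hu).2.trans (mul_le_mul_right hnorm _))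
    rw [← ENNReal.coe_inv hX0.ne'] at h
    exact_mod_cast h
  have hρm : ρ ^ m ≤ P * V ^ ((m : ℝ) / n) := by
    rw [inv_le_iff_one_le_mul₀ hX0, ← mul_div_assoc, div_mul_eq_mul_div,
      one_le_div (by positivity)] at hmain
    have h2 : nnInv A s ≤ 2 * nnInv A V⁻¹ := hA.nnInv_two_mul_le _
    have h3 : (s ^ ((m : ℝ) / n))⁻¹ ≤ V ^ ((m : ℝ) / n) := by
      rw [← NNReal.inv_rpow]
      refine NNReal.rpow_le_rpow ?_ (by positivity)
      rw [hs, mul_inv, inv_inv]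
      exact mul_le_of_le_one_left' (inv_le_one_of_one_le₀ one_le_two)
    refine le_of_mul_le_mul_right ?_ hg'
    calc ρ ^ m * nnInv A V⁻¹ ≤ Ce * D * X := hmain
      _ = Ce * D * (K + 1) * nnInv A s * (s ^ ((m : ℝ) / n))⁻¹ := by
          rw [hX, div_eq_mul_inv]; ring
      _ ≤ Ce * D * (K + 1) * (2 * nnInv A V⁻¹) * V ^ ((m : ℝ) / n) := by gcongr
      _ = P * V ^ ((m : ℝ) / n) * nnInv A V⁻¹ := by rw [hP]; ring
  have hm0 : (m : ℝ) ≠ 0 := by exact_mod_cast (by omega : m ≠ 0)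
  have hρfin : ρ ≤ P ^ (1 / m : ℝ) * V ^ (1 / n : ℝ) := by
    have h := NNReal.rpow_le_rpow hρm (by positivity : (0 : ℝ) ≤ 1 / m)
    rw [← NNReal.rpow_natCast, ← NNReal.rpow_mul, mul_one_div_cancel hm0, NNReal.rpow_one,
      NNReal.mul_rpow, ← NNReal.rpow_mul] at h
    have e : (m : ℝ) / n * (1 / m) = 1 / n := by field_simp
    rwa [e] at h
  have hfin' : (ρ : ℝ) ≤ (P ^ (1 / m : ℝ) : ℝ≥0) * (V : ℝ) ^ (1 / n : ℝ) := by
    rw [← NNReal.coe_rpow, ← NNReal.coe_mul]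
    exact NNReal.coe_le_coe.2 hρfin
  rw [hρR] at hfin'
  push_cast at hfin' ⊢
  linarith

end Gap

/-! ### Iteration over halving radii -/

section Iteration

variable {V : ℝ → ℝ} {C e v₀ : ℝ}

theorem exists_halving_radius (hpos : ∀ r, 0 < r → 0 < V r)
    (hsmall : ∀ R ε, 0 < R → 0 < ε → ∃ r, 0 < r ∧ r < R ∧ V r ≤ ε) (hC : 0 < C)
    (hgap : ∀ r R, 0 < r → r < R → R ≤ 1 → V R ≤ v₀ → V R / 2 ≤ V r → R - r ≤ C * V R ^ e)
    {R : ℝ} (hR0 : 0 < R) (hR1 : R ≤ 1) (hRv : V R ≤ v₀) :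
    ∃ r, 0 < r ∧ r ≤ R ∧ V r ≤ V R / 2 ∧ R - r ≤ 2 * C * V R ^ e := by
  set T : Set ℝ := {r | 0 < r ∧ r ≤ R ∧ V r ≤ V R / 2} with hT
  obtain ⟨r₁, hr₁, hr₁R, hVr₁⟩ := hsmall R (V R / 2) hR0 (half_pos (hpos R hR0))
  have hne : T.Nonempty := ⟨r₁, hr₁, hr₁R.le, hVr₁⟩
  have hbdd : BddAbove T := ⟨R, fun r hr => hr.2.1⟩
  set η := C * V R ^ e with hη
  have hη0 : 0 < η := mul_pos hC (Real.rpow_pos_of_pos (hpos R hR0) e)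
  have hsup : R - sSup T ≤ η := by
    by_contra! hcon
    obtain ⟨r, hr1, hr2⟩ := exists_between (show sSup T < R - η by linarith)
    have hr0 : 0 < r := hr₁.trans_le ((le_csSup hbdd ⟨hr₁, hr₁R.le, hVr₁⟩).trans hr1.le)
    have hrT : r ∉ T := fun h => (le_csSup hbdd h).not_gt hr1
    have hVr : V R / 2 ≤ V r := by
      by_contra! h
      exact hrT ⟨hr0, by linarith, h.le⟩
    have := hgap r R hr0 (by linarith) hR1 hRv hVr
    linarith
  obtain ⟨r, hr, hlt⟩ := exists_lt_of_lt_csSup hne (show sSup T - η < sSup T by linarith)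
  exact ⟨r, hr.1, hr.2.1, hr.2.2, by linarith⟩

/-- The gaps between successive halving radii form a geometric series: they are bounded by the
increments of a multiple of `V ^ e`. -/
theorem le_mul_rpow_of_gap (hmono : Monotone V) (hpos : ∀ r, 0 < r → 0 < V r)
    (hsmall : ∀ R ε, 0 < R → 0 < ε → ∃ r, 0 < r ∧ r < R ∧ V r ≤ ε) (hC : 0 < C) (he : 0 < e)
    (hgap : ∀ r R, 0 < r → r < R → R ≤ 1 → V R ≤ v₀ → V R / 2 ≤ V r → R - r ≤ C * V R ^ e)
    {R : ℝ} (hR0 : 0 < R) (hR1 : R ≤ 1) (hRv : V R ≤ v₀) :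
    R ≤ 2 * C / (1 - (1 / 2) ^ e) * V R ^ e := by
  have hq1 : ((1 : ℝ) / 2) ^ e < 1 := Real.rpow_lt_one (by norm_num) (by norm_num) he
  set q := ((1 : ℝ) / 2) ^ e with hq
  set C' := 2 * C / (1 - q) with hC'
  have hC'0 : 0 < C' := div_pos (by linarith) (by linarith)
  have hC'q : C' * (1 - q) = 2 * C := div_mul_cancel₀ _ (by linarith)
  have key : ∀ k : ℕ, ∃ r, 0 < r ∧ r ≤ R ∧ V r ≤ (1 / 2) ^ k * V R ∧
      R - r ≤ C' * (V R ^ e - V r ^ e) := by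
    intro k
    induction k with
    | zero => exact ⟨R, hR0, le_rfl, by simp, by simp⟩
    | succ k ih =>
      obtain ⟨r, hr0, hrR, hVr, hr⟩ := ih
      obtain ⟨r', hr'0, hr'r, hVr', hr'⟩ := exists_halving_radius hpos hsmall hC hgap hr0
        (hrR.trans hR1) ((hmono hrR).trans hRv)
      refine ⟨r', hr'0, hr'r.trans hrR, ?_, ?_⟩
      · rw [pow_succ]; linarith
      · have h1 : V r' ^ e ≤ q * V r ^ e := by
          rw [hq, ← Real.mul_rpow (by norm_num) (hpos r hr0).le]
          exact Real.rpow_le_rpow (hpos r' hr'0).le (by linarith) he.le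
        have h2 : C' * (1 - q) * V r ^ e ≤ C' * (V r ^ e - V r' ^ e) := by
          rw [mul_assoc]
          exact mul_le_mul_of_nonneg_left (by linarith) hC'0.le
        rw [hC'q] at h2
        linarith
  refine le_of_forall_pos_le_add fun ε hε => ?_
  obtain ⟨k, hk⟩ := exists_pow_lt_of_lt_one (div_pos (hpos ε hε) (hpos R hR0))
    (by norm_num : (1 / 2 : ℝ) < 1)
  obtain ⟨r, hr0, -, hVr, hr⟩ := key k
  have hrε : r < ε := hmono.reflect_lt (hVr.trans_lt ((lt_div_iff₀ (hpos R hR0)).1 hk))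
  have h3 : 0 ≤ C' * V r ^ e := mul_nonneg hC'0.le (Real.rpow_nonneg (hpos r hr0).le e)
  linarith

end Iteration

/-! ### Volume of cubes -/

section Cube

variable {n : ℕ}

theorem cube_mono (x : EuclideanSpace ℝ (Fin n)) : Monotone (cube x) :=
  fun _ _ h _ hy i => (hy i).trans_le h

theorem mem_cube_self (x : EuclideanSpace ℝ (Fin n)) {r : ℝ} (hr : 0 < r) : x ∈ cube x r :=
  fun i => by simpa using hr

theorem cube_subset_ball (hn : 0 < n) (x : EuclideanSpace ℝ (Fin n)) (r : ℝ) :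
    cube x r ⊆ Metric.ball x (n * r) := by
  intro y hy
  have hr : 0 < r := (abs_nonneg _).trans_lt (hy ⟨0, hn⟩)
  have hn1 : (1 : ℝ) ≤ n := by exact_mod_cast hn
  rw [Metric.mem_ball, EuclideanSpace.dist_eq, Real.sqrt_lt' (by positivity)]
  calc ∑ i, dist (y i) (x i) ^ 2 < ∑ _i : Fin n, r ^ 2 := by
        refine Finset.sum_lt_sum_of_nonempty ⟨⟨0, hn⟩, Finset.mem_univ _⟩ fun i _ => ?_
        rw [Real.dist_eq]
        exact pow_lt_pow_left₀ (hy i) (abs_nonneg _) two_ne_zero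
    _ = n * r ^ 2 := by simp
    _ ≤ (n * r) ^ 2 := by
        rw [mul_pow]
        gcongr
        nlinarith

theorem exists_volume_cube_le (hn : 0 < n) (x : EuclideanSpace ℝ (Fin n)) {R ε : ℝ} (hR : 0 < R)
    (hε : 0 < ε) : ∃ r, 0 < r ∧ r < R ∧ volume (cube x r) ≤ ENNReal.ofReal ε := by
  set b := (volume (Metric.ball (0 : EuclideanSpace ℝ (Fin n)) 1)).toReal with hb
  have ht : Tendsto (fun r : ℝ => (n * r) ^ n * b) (nhdsWithin 0 (Ioi 0)) (nhds 0) := by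
    have h : Continuous fun r : ℝ => (n * r) ^ n * b := by fun_prop
    have h0 := h.tendsto 0
    simp only [mul_zero, zero_pow hn.ne', zero_mul] at h0
    exact h0.mono_left nhdsWithin_le_nhds
  obtain ⟨r, h1, h2, h3⟩ := ((ht.eventually (gt_mem_nhds hε)).and
    (Ioo_mem_nhdsGT hR)).exists
  refine ⟨r, h2, h3, (measure_mono (cube_subset_ball hn x r)).trans ?_⟩
  rw [Measure.addHaar_ball_of_pos _ _ (by positivity), finrank_euclideanSpace_fin,
    ← ENNReal.ofReal_toReal (measure_ball_lt_top (x := (0 : EuclideanSpace ℝ (Fin n)))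
      (r := 1)).ne, ← ENNReal.ofReal_mul (by positivity)]
  exact ENNReal.ofReal_le_ofReal h1.le

end Cube

end OrliczSobolev

/-! ### The measure density condition -/

open OrliczSobolev

theorem theorem2 (n m : ℕ) (hm : 1 ≤ m) (hmn : m < n)
    (A : ℝ≥0 → ℝ≥0∞) (hA : OrliczSobolev.IsYoung A)
    (hfin : ∃ δ : ℝ≥0, 0 < δ ∧ OrliczSobolev.subcritIntegral n m A δ < ∞)
    (hI : OrliczSobolev.upperBoydIndex A < (n : ℝ≥0∞) / (m : ℝ≥0∞))
    (Ω : Set (EuclideanSpace ℝ (Fin n))) (hΩ : IsOpen Ω)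
    (hemb : OrliczSobolev.ContinuousEmbedding m A (OrliczSobolev.sobolevConj n m A) Ω) :
    OrliczSobolev.MeasureDensity Ω := by
  have hn : 0 < n := by omega
  have hnR : (0 : ℝ) < n := by exact_mod_cast hn
  have hn1 : (1 : ℝ) ≤ n := by exact_mod_cast hn
  obtain ⟨C, v₀, hv₀, hgap⟩ := exists_gap_le hm hmn hA hfin hI hΩ hemb
  set e : ℝ := 1 / n with he
  have he0 : 0 < e := by positivity
  set C' : ℝ := 2 * (C + 1) / (1 - (1 / 2) ^ e) with hC'
  have hC'0 : 0 < C' := by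
    have : ((1 : ℝ) / 2) ^ e < 1 := Real.rpow_lt_one (by norm_num) (by norm_num) he0
    exact div_pos (by positivity) (by linarith)
  set c₀ : ℝ := min v₀ (C'⁻¹ ^ n) with hc₀
  have hc₀0 : 0 < c₀ := lt_min (by exact_mod_cast hv₀) (by positivity)
  refine ⟨c₀ / n ^ n, by positivity, fun x hx R hR0 hR1 => ?_⟩
  -- The density is proved for the cube of half side `R / n`, which lies in the ball.
  set ρ : ℝ := R / n with hρ
  have hρ0 : 0 < ρ := by positivity
  have hρ1 : ρ ≤ 1 := div_le_one_of_le₀ (hR1.trans hn1) hnR.le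
  set W : ℝ → ℝ := fun r => (volume (cube x r ∩ Ω)).toReal with hW
  have hfinite : ∀ r, volume (cube x r ∩ Ω) ≠ ∞ := fun r =>
    (((measure_mono inter_subset_left).trans (measure_mono (cube_subset_ball hn x r))).trans_lt
      measure_ball_lt_top).ne
  have hmono : Monotone W := fun r s h =>
    ENNReal.toReal_mono (hfinite s) (measure_mono (inter_subset_inter_left _ (cube_mono x h)))
  have hpos : ∀ r, 0 < r → 0 < W r := fun r hr => ENNReal.toReal_pos
    (((isOpen_cube x r).inter hΩ).measure_pos volume ⟨x, mem_cube_self x hr, hx⟩).ne' (hfinite r)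
  have hsmall : ∀ R ε, 0 < R → 0 < ε → ∃ r, 0 < r ∧ r < R ∧ W r ≤ ε := by
    intro R ε hR hε
    obtain ⟨r, hr0, hrR, hr⟩ := exists_volume_cube_le hn x hR hε
    exact ⟨r, hr0, hrR, ENNReal.toReal_le_of_le_ofReal hε.le
      ((measure_mono inter_subset_left).trans hr)⟩
  have hgapW : ∀ r R, 0 < r → r < R → R ≤ 1 → W R ≤ v₀ → W R / 2 ≤ W r →
      R - r ≤ (C + 1) * W R ^ e := by
    intro r R hr hrR hR1 hRv hhalf
    have hcoe : ((volume (cube x R ∩ Ω)).toNNReal : ℝ) = W R := rfl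
    have h := hgap x r R (volume (cube x R ∩ Ω)).toNNReal hr hrR hR1
      (by rw [← NNReal.coe_pos, hcoe]; exact hpos R (hr.trans hrR))
      (by rw [← NNReal.coe_le_coe, hcoe]; exact hRv) (ENNReal.coe_toNNReal (hfinite R)).symm ?_
    · rw [hcoe] at h
      refine h.trans ?_
      gcongr
      linarith
    · rw [← ENNReal.coe_toNNReal (hfinite r), ENNReal.coe_le_coe, ← NNReal.coe_le_coe]
      exact hhalf
  have hmain : c₀ * ρ ^ n ≤ W ρ := by
    rcases le_total (W ρ) v₀ with hle | hle
    · have h := le_mul_rpow_of_gap hmono hpos hsmall (by positivity) he0 hgapW hρ0 hρ1 hle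
      have h2 : C'⁻¹ * ρ ≤ W ρ ^ e := by
        rw [inv_mul_le_iff₀ hC'0]; exact h
      calc c₀ * ρ ^ n ≤ C'⁻¹ ^ n * ρ ^ n := by gcongr; exact min_le_right _ _
        _ = (C'⁻¹ * ρ) ^ n := (mul_pow _ _ _).symm
        _ ≤ (W ρ ^ e) ^ n := by gcongr
        _ = W ρ := by
          rw [← Real.rpow_natCast, ← Real.rpow_mul (hpos ρ hρ0).le, he,
            one_div_mul_cancel hnR.ne', Real.rpow_one]
    · calc c₀ * ρ ^ n ≤ v₀ * 1 := by
            gcongr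
            · exact min_le_left _ _
            · exact pow_le_one₀ hρ0.le hρ1
        _ = v₀ := mul_one _
        _ ≤ W ρ := hle
  calc ENNReal.ofReal (c₀ / n ^ n * R ^ n) = ENNReal.ofReal (c₀ * ρ ^ n) := by
        rw [hρ, div_pow, div_mul_eq_mul_div, mul_div_assoc]
    _ ≤ ENNReal.ofReal (W ρ) := ENNReal.ofReal_le_ofReal hmain
    _ = volume (cube x ρ ∩ Ω) := ENNReal.ofReal_toReal (hfinite ρ)
    _ ≤ volume (Metric.ball x R ∩ Ω) := by
        refine measure_mono (inter_subset_inter_left _ ?_)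
        have h := cube_subset_ball hn x ρ
        rwa [hρ, mul_div_cancel₀ _ hnR.ne'] at h
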